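/- A tensor $p=(p(i,j|x,y))_{i,j\in\{0,1\},\,x,y\in\{1,2,3\}}\in\mathbb R^{36}$ belongs to $C_q^s(3,2)$ if there are finite-dimensional Hilbert spaces $H_a,H_b$, projection valued measures $\{E_{x,0},E_{x,1}\}$ on $H_a$ and $\{F_{y,0},F_{y,1}\}$ on $H_b$ ($x,y\in\{1,2,3\}$), and a unit vector $\phi\in H_a\otimes H_b$ such that $p(i,j|x,y)=\langle\phi,(E_{x,i}\otimes F_{y,j})\phi\rangle$ for all $i,j,x,y$, and if moreover $p(i,j|x,x)=0$ for all $x$ and all $i\neq j$. For such $p$ write $p(0|x)=\sum_j p(0,j|x,x)$. For $\vec r=(r_1,r_2,r_3)\in\mathbb R^3$ let $$\hat S_{\vec r}[C_q^s(3,2)]=\{(p(0,0|1,2),\,p(0,0|1,3),\,p(0,0|2,3)) : p\in C_q^s(3,2),\ p(0|x)=r_x \text{ for } x=1,2,3\}\subseteq\mathbb R^3 ,$$ and let $$S_2(1)=\{(\tfrac12\mathrm{Tr}(P_1P_2),\tfrac12\mathrm{Tr}(P_1P_3),\tfrac12\mathrm{Tr}(P_2P_3)) : P_1,P_2,P_3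 \text{ rank-one orthogonal projections on } \mathbb C^2\}.$$ Call $\vec r$ standard if $0\le r_1\le r_2\le r_3\le 1/2$. Theorem. (a) If $\vec r$ is standard, then $\hat S_{\vec r}[C_q^s(3,2)]$ is the convex hull of the union of the three sets $$D_1^{\vec r}=2\max(0,r_1+r_2+r_3-1)\,S_2(1),\qquad D_2^{\vec r}=2r_1S_2(1)+\{(0,0,t):0\le t\le r_2-r_1\},$$ $$D_3^{\vec r}=2\max(0,r_1+r_2-r_3)\,S_2(1)+(0,\min(r_1,r_3-r_2),\min(r_2,r_3-r_1)).$$ (b) $S_2(1)$ is an affine image of the $3\times3$ elliptope: $S_2(1)$ is the set of all $\tfrac14\big((a_{12},a_{13},a_{23})+(1,1,1)\big)$, where $A=(a_{ij})$ ranges over the real positive semidefinite $3\times3$ matrices with all diagonal entries equal to $1$. (c) Every slice is an affine image of a standard slice: for every $\vec s\in[0,1]^3$ there is a permutation $\sigma$ of $\{1,2,3\}$ such that the vector $\vec r$ with entries $r_x=\min(s_{\sigma(x)},1-s_{\sigma(x)})$ is standard, and an invertible affine map $T:\mathbb R^3\to\mathbb R^3$ with $\hat S_{\vec s}[C_q^s(3,2)]=T\big(\hat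 S_{\vec r}[C_q^s(3,2)]\big)$. (d) Consequently, $C_q^s(3,2)$ is a closed subset of $\mathbb R^{36}$. -/

import Mathlib

open scoped Pointwise Kronecker Matrix

/-- Tensors `p i j x y = p(i,j|x,y)` for `n` experiments `x, y` with `m` outcomes `i, j` each. -/
abbrev CorrTensor (n m : ℕ) : Type := Fin m → Fin m → Fin n → Fin n → ℝ

/-- A projection valued measure on `ℂ^d` with `m` outcomes: orthogonal projections
with sum the identity. -/
def IsPVM {d m : ℕ} (E : Fin m → Matrix (Fin d) (Fin d) ℂ) : Prop :=
  (∀ i, IsStarProjection (E i)) ∧ ∑ i, E i = 1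

/-- The quantum correlations `C_q(n,m)`: `p(i,j|x,y) = ⟨φ, (E_{x,i} ⊗ F_{y,j}) φ⟩` for projection
valued measures on finite-dimensional Hilbert spaces `ℂ^a` and `ℂ^b` and a unit vector `φ` of
`ℂ^a ⊗ ℂ^b`, which is identified with `ℂ^(a × b)`. -/
def quantumCorr (n m : ℕ) : Set (CorrTensor n m) :=
  {p | ∃ (a b : ℕ) (E : Fin n → Fin m → Matrix (Fin a) (Fin a) ℂ)
      (F : Fin n → Fin m → Matrix (Fin b) (Fin b) ℂ) (φ : Fin a × Fin b → ℂ),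
      (∀ x, IsPVM (E x)) ∧ (∀ y, IsPVM (F y)) ∧ star φ ⬝ᵥ φ = 1 ∧
      ∀ i j x y, (p i j x y : ℂ) = star φ ⬝ᵥ ((E x i ⊗ₖ F y j) *ᵥ φ)}

/-- A correlation is synchronous if `p(i,j|x,x) = 0` whenever `i ≠ j`. -/
def IsSynchronous {n m : ℕ} (p : CorrTensor n m) : Prop :=
  ∀ x i j, i ≠ j → p i j x x = 0

/-- The synchronous quantum correlations `C_q^s(n,m)`. -/
def syncQuantumCorr (n m : ℕ) : Set (CorrTensor n m) :=
  {p | p ∈ quantumCorr n m ∧ IsSynchronous p}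

/-- The marginal `p(i|x) = ∑ j, p(i,j|x,x)`; for a quantum correlation, `∑ j, p(i,j|x,y)` does
not depend on `y`. -/
def marginal {n m : ℕ} (p : CorrTensor n m) (i : Fin m) (x : Fin n) : ℝ :=
  ∑ j, p i j x x

/-- The strictly upper triangular entries `(w₁₂, w₁₃, w₂₃)` of a `3 × 3` array. -/
def upperEntries (w : Fin 3 → Fin 3 → ℝ) : Fin 3 → ℝ := ![w 0 1, w 0 2, w 1 2]

/-- The slice `Ŝ_r[C_q^s(3,2)]`: the vectors `(p(0,0|1,2), p(0,0|1,3), p(0,0|2,3))` of the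
correlations `p` in `C_q^s(3,2)` with marginals `p(0|x) = r_x`. -/
def hatSlice (r : Fin 3 → ℝ) : Set (Fin 3 → ℝ) :=
  {w | ∃ p ∈ syncQuantumCorr 3 2, (∀ x, marginal p 0 x = r x) ∧
      w = upperEntries (fun x y => p 0 0 x y)}

/-- The normalized trace on `d × d` matrices. -/
noncomputable def normTrace {d : ℕ} (A : Matrix (Fin d) (Fin d) ℂ) : ℂ :=
  (d : ℂ)⁻¹ * A.trace

/-- The set `S_d(N₁, N₂, N₃)` of all `(tr_d(P₁P₂), tr_d(P₁P₃), tr_d(P₂P₃))` with `P_i` projections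
on `ℂ^d` such that `tr_d(P_i) = N_i / d`. -/
def projCorr (d : ℕ) (N : Fin 3 → ℕ) : Set (Fin 3 → ℝ) :=
  {w | ∃ (P : Fin 3 → Matrix (Fin d) (Fin d) ℂ) (q : Fin 3 → Fin 3 → ℝ),
      (∀ x, IsStarProjection (P x)) ∧ (∀ x, normTrace (P x) = (N x : ℂ) / (d : ℂ)) ∧
      (∀ x y, (q x y : ℂ) = normTrace (P x * P y)) ∧ w = upperEntries q}

/-- The set `S_2(1) = S_2(1,1,1)`. -/
def S21 : Set (Fin 3 → ℝ) := projCorr 2 (fun _ => 1)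

/-- The `n × n` elliptope. -/
def elliptope (n : ℕ) : Set (Matrix (Fin n) (Fin n) ℝ) :=
  {A | A.PosSemidef ∧ ∀ i, A i i = 1}

/-- Standard vectors: `0 ≤ r₁ ≤ r₂ ≤ r₃ ≤ 1/2`. -/
def IsStandardVec (r : Fin 3 → ℝ) : Prop :=
  0 ≤ r 0 ∧ r 0 ≤ r 1 ∧ r 1 ≤ r 2 ∧ r 2 ≤ 1 / 2

/-- `D₁ = 2 max(0, r₁ + r₂ + r₃ - 1) S_2(1)`. -/
def D1 (r : Fin 3 → ℝ) : Set (Fin 3 → ℝ) :=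
  (2 * max 0 (r 0 + r 1 + r 2 - 1)) • S21

/-- `D₂ = 2 r₁ S_2(1) + (0, 0, [0, r₂ - r₁])`. -/
def D2 (r : Fin 3 → ℝ) : Set (Fin 3 → ℝ) :=
  (2 * r 0) • S21 + {v | ∃ t ∈ Set.Icc 0 (r 1 - r 0), v = ![0, 0, t]}

/-- `D₃ = 2 max(0, r₁ + r₂ - r₃) S_2(1) + (0, min(r₁, r₃ - r₂), min(r₂, r₃ - r₁))`. -/
def D3 (r : Fin 3 → ℝ) : Set (Fin 3 → ℝ) :=
  (2 * max 0 (r 0 + r 1 - r 2)) • S21 + {![0, min (r 0) (r 2 - r 1), min (r 1) (r 2 - r 0)]}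

/-! Write the state as a matrix `X`. Synchronicity forces `F_{x,i} X = X E_{x,i}ᵀ`, so the density
matrix `ρ = Xᴴ X` commutes with the (transposed) projections on Alice's side. With `τ = Tr(ρ ·)` the
correlations become `τ(E_{x,i} E_{y,j})`, and for two outcomes they are determined by the numbers
`τ(P_x P_y)` of three projections. The core of the proof is that these arrays form exactly
`tracialModel`: mixtures of the eight deterministic triples and of triples of rank-one projections
on a qubit.

The model is convex and compact, so by Hahn-Banach it suffices to bound a generic linear functional
on triples of projections. At a maximizing triple each projection is optimal given the other two,
hence commutes with a linear combination of them (`commute_of_traceRe_isMax`). These relations make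
all commutators proportional to one matrix `K`, which anticommutes with the symmetries `2 P_x - 1`.
On the kernel of `K` the projections commute and have a joint distribution; off the kernel the
symmetries have trace zero and only their Gram matrix matters (`mem_tracialModel_of_commutators`).
Conversely, three unit vectors with a prescribed Gram matrix fit into `ℝ³`, so they are Bloch
vectors of qubit projections; this also gives (b).

Closedness follows because the correlations are a continuous image of a compact set. Permuting the
projections and replacing some `P_x` by `1 - P_x` preserves the model and gives (c). For (a), a
slice is described by eight weights and a Gram matrix. Complementary deterministic triples of equal
weight can be absorbed into the Gram part, and comparing the weights within each complementary pair
places the point in some `D_i` or on a segment joining `D₁` to `D₂` or `D₂` to `D₃`. -/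

/-! ### Functional calculus for Hermitian matrices -/

section FunctionalCalculus

open scoped ComplexOrder

variable {𝕜 : Type*} [RCLike 𝕜] {d : Type*} [Fintype d] [DecidableEq d]

theorem continuousOn_spectrum_of_matrix (f : ℝ → ℝ) (H : Matrix d d 𝕜) :
    ContinuousOn f (spectrum ℝ H) :=
  (Matrix.finite_real_spectrum (A := H)).continuousOn f

theorem cfc_matrix_mul (f g : ℝ → ℝ) (H : Matrix d d 𝕜) :
    cfc f H * cfc g H = cfc (fun x => f x * g x) H :=
  (cfc_mul f g H (continuousOn_spectrum_of_matrix f H)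
    (continuousOn_spectrum_of_matrix g H)).symm

theorem conjTranspose_cfc_matrix (f : ℝ → ℝ) (H : Matrix d d 𝕜) : (cfc f H)ᴴ = cfc f H :=
  (cfc_predicate f H : IsSelfAdjoint (cfc f H))

theorem posSemidef_cfc_matrix (f : ℝ → ℝ) (hf : ∀ x, 0 ≤ f x) (H : Matrix d d 𝕜) :
    (cfc f H).PosSemidef := by
  have h := Matrix.posSemidef_conjTranspose_mul_self (cfc (fun x => Real.sqrt (f x)) H)
  rw [conjTranspose_cfc_matrix, cfc_matrix_mul] at h
  simpa [Real.mul_self_sqrt, hf] using h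

theorem exists_sqrt_commute {ρ : Matrix d d 𝕜} (hρ : ρ.PosSemidef) :
    ∃ S : Matrix d d 𝕜, Sᴴ = S ∧ S * S = ρ ∧ ∀ A, Commute A ρ → Commute A S := by
  have hsa : IsSelfAdjoint ρ := hρ.isHermitian
  refine ⟨cfc Real.sqrt ρ, conjTranspose_cfc_matrix _ _, ?_, fun A hA => (hA.symm.cfc_real _).symm⟩
  rw [cfc_matrix_mul]
  conv_rhs => rw [← cfc_id ℝ ρ]
  refine cfc_congr fun x hx => ?_
  refine Real.mul_self_sqrt ?_
  obtain ⟨i, rfl⟩ := by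
    rw [hρ.isHermitian.spectrum_real_eq_range_eigenvalues] at hx
    exact hx
  exact hρ.eigenvalues_nonneg i

/-- The spectral decomposition of a Hermitian matrix into its positive and negative parts. -/
theorem exists_positive_spectral_projection {H : Matrix d d 𝕜} (hH : H.IsHermitian) :
    ∃ Q : Matrix d d 𝕜, IsStarProjection Q ∧ (∀ A, Commute A H → Commute A Q) ∧
      (Q * H).PosSemidef ∧ (-((1 - Q) * H)).PosSemidef := by
  have hsa : IsSelfAdjoint H := hH
  set f : ℝ → ℝ := fun x => if 0 < x then 1 else 0 with hf
  have hid : cfc (fun x : ℝ => x) H = H := cfc_id' ℝ H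
  have h1 : cfc f H * H = cfc (fun x => f x * x) H := by
    rw [← cfc_matrix_mul, hid]
  refine ⟨cfc f H, ⟨?_, conjTranspose_cfc_matrix _ _⟩,
    fun A hA => (hA.symm.cfc_real _).symm, ?_, ?_⟩
  · rw [IsIdempotentElem, cfc_matrix_mul]
    congr 1
    ext x
    simp [hf]
  · rw [h1]
    refine posSemidef_cfc_matrix _ (fun x => ?_) _
    simp only [hf]
    split_ifs with h
    · simpa using h.le
    · simp
  · have h2 : -((1 - cfc f H) * H) = cfc (fun x => f x * x - x) H := by
      rw [cfc_sub _ _ H (continuousOn_spectrum_of_matrix _ H)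
        (continuousOn_spectrum_of_matrix _ H), hid, ← h1]
      noncomm_ring
    rw [h2]
    refine posSemidef_cfc_matrix _ (fun x => ?_) _
    simp only [hf]
    split_ifs with h
    · simp
    · simpa using h

/-- The projection onto the kernel of a Hermitian matrix, and its pseudo-inverse. -/
theorem exists_kernel_projection {H : Matrix d d 𝕜} (hH : H.IsHermitian) :
    ∃ Q R : Matrix d d 𝕜, IsStarProjection Q ∧ (∀ A, Commute A H → Commute A Q) ∧
      (∀ A, Commute A H → Commute A R) ∧ H * Q = 0 ∧ 1 - Q = H * R := by
  have hsa : IsSelfAdjoint H := hH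
  set f : ℝ → ℝ := fun x => if x = 0 then 1 else 0 with hf
  have hid : cfc (fun x : ℝ => x) H = H := cfc_id' ℝ H
  refine ⟨cfc f H, cfc (fun x => x⁻¹) H, ⟨?_, conjTranspose_cfc_matrix _ _⟩,
    fun A hA => (hA.symm.cfc_real _).symm, fun A hA => (hA.symm.cfc_real _).symm, ?_, ?_⟩
  · rw [IsIdempotentElem, cfc_matrix_mul]
    congr 1
    ext x
    simp [hf]
  · nth_rewrite 1 [← hid]
    have h0 : (fun x => x * f x) = fun _ : ℝ => (0 : ℝ) := by
      ext x
      simp +contextual [hf]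
    rw [cfc_matrix_mul, h0, cfc_const_zero]
  · nth_rewrite 2 [← hid]
    rw [cfc_matrix_mul, ← cfc_one ℝ H, ← cfc_sub _ _ H (continuousOn_spectrum_of_matrix _ H)
        (continuousOn_spectrum_of_matrix _ H)]
    congr 1
    ext x
    by_cases h : x = 0 <;> simp [hf, h]

end FunctionalCalculus

/-! ### Trace functionals of a density matrix -/

section TracialStates

open scoped ComplexOrder

variable {d : Type*} [Fintype d] [DecidableEq d]

/-- The real linear functional `Z ↦ Re Tr(ρ Z)`. -/
noncomputable def traceRe (ρ : Matrix d d ℂ) : Matrix d d ℂ →ₗ[ℝ] ℝ where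
  toFun Z := (ρ * Z).trace.re
  map_add' := by simp [mul_add]
  map_smul' := by simp

theorem traceRe_apply (ρ Z : Matrix d d ℂ) : traceRe ρ Z = (ρ * Z).trace.re := rfl

/-- Taking adjoints reverses the product and preserves the real part of the trace; since only the
real part is kept, `A` and `B` need not commute with `ρ`. -/
theorem traceRe_mul_symm {ρ Q : Matrix d d ℂ} (hρ : ρᴴ = ρ) (hQ : Qᴴ = Q) (hc : Commute Q ρ)
    {A B : Matrix d d ℂ} (hA : Aᴴ = A) (hB : Bᴴ = B) :
    traceRe ρ (Q * (A * B)) = traceRe ρ (Q * (B * A)) := by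
  have h : (ρ * (Q * (A * B))).trace.re = ((ρ * (Q * (A * B)))ᴴ).trace.re := by
    rw [Matrix.trace_conjTranspose]; simp
  rw [traceRe_apply, h]
  simp only [Matrix.conjTranspose_mul, hρ, hQ, hA, hB]
  rw [traceRe_apply, mul_assoc, Matrix.trace_mul_comm, mul_assoc, ← mul_assoc Q, hc.eq, mul_assoc]

/-- A trace against a positive matrix becomes a squared Hilbert-Schmidt norm, which gives both
positivity and, for invertible `ρ`, faithfulness. -/
theorem traceRe_projection_mul_eq {ρ : Matrix d d ℂ} {S Q D : Matrix d d ℂ} (hS : Sᴴ = S)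
    (hSρ : S * S = ρ) (hD : Dᴴ = D) (hQ : IsStarProjection Q) (hQS : Commute Q S) :
    (ρ * (Q * (D * D))).trace = ((S * (Q * D))ᴴ * (S * (Q * D))).trace := by
  have hQs : Qᴴ = Q := hQ.isSelfAdjoint
  have hQi : Q * Q = Q := hQ.isIdempotentElem
  simp only [Matrix.conjTranspose_mul, hS, hD, hQs]
  have h : D * Q * S * (S * (Q * D)) = D * (ρ * (Q * D)) := by
    have hc : Q * S = S * Q := hQS
    calc D * Q * S * (S * (Q * D)) = D * (Q * S) * S * Q * D := by simp only [mul_assoc]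
      _ = D * (S * Q) * S * Q * D := by rw [hc]
      _ = D * S * (Q * S) * Q * D := by simp only [mul_assoc]
      _ = D * S * S * (Q * Q) * D := by rw [hc]; simp only [mul_assoc]
      _ = _ := by rw [hQi, ← hSρ]; simp only [mul_assoc]
  rw [h, Matrix.trace_mul_comm D]
  simp only [mul_assoc]

theorem traceRe_projection_mul_nonneg {ρ : Matrix d d ℂ} (hρ : ρ.PosSemidef)
    {Q : Matrix d d ℂ} (hQ : IsStarProjection Q) (hc : Commute Q ρ) {B : Matrix d d ℂ}
    (hB : B.PosSemidef) : 0 ≤ traceRe ρ (Q * B) := by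
  obtain ⟨S, hS, hSρ, hSc⟩ := exists_sqrt_commute hρ
  obtain ⟨D, hD, rfl, -⟩ := exists_sqrt_commute hB
  rw [traceRe_apply, traceRe_projection_mul_eq hS hSρ hD hQ (hSc Q hc)]
  exact (Complex.nonneg_iff.1 (Matrix.posSemidef_conjTranspose_mul_self _).trace_nonneg).1

theorem traceRe_projection_nonneg {ρ : Matrix d d ℂ} (hρ : ρ.PosSemidef)
    {Q : Matrix d d ℂ} (hQ : IsStarProjection Q) (hc : Commute Q ρ) : 0 ≤ traceRe ρ Q := by
  simpa using traceRe_projection_mul_nonneg hρ hQ hc Matrix.PosSemidef.one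

theorem projection_mul_eq_zero_of_traceRe {ρ : Matrix d d ℂ} (hρ : ρ.PosDef)
    {Q : Matrix d d ℂ} (hQ : IsStarProjection Q) (hc : Commute Q ρ) {B : Matrix d d ℂ}
    (hB : B.PosSemidef) (h0 : traceRe ρ (Q * B) = 0) : Q * B = 0 := by
  obtain ⟨S, hS, hSρ, hSc⟩ := exists_sqrt_commute hρ.posSemidef
  obtain ⟨D, hD, rfl, -⟩ := exists_sqrt_commute hB
  rw [traceRe_apply, traceRe_projection_mul_eq hS hSρ hD hQ (hSc Q hc)] at h0
  have hn := Complex.nonneg_iff.1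
    (Matrix.posSemidef_conjTranspose_mul_self (S * (Q * D))).trace_nonneg
  have h1 : S * (Q * D) = 0 :=
    Matrix.trace_conjTranspose_mul_self_eq_zero_iff.1 (Complex.ext h0 hn.2.symm)
  have h2 : ρ * (Q * D) = 0 := by rw [← hSρ, mul_assoc, h1, mul_zero]
  have h3 : Q * D = 0 := by
    simpa using (hρ.isUnit.mul_right_eq_zero).1 h2
  rw [← mul_assoc, h3, zero_mul]

/-- A projection that maximizes `A ↦ Tr(ρ A H)` in the commutant of `ρ` commutes with `H`. -/
theorem commute_of_traceRe_isMax {ρ : Matrix d d ℂ} (hρ : ρ.PosDef) {A H : Matrix d d ℂ}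
    (hA : IsStarProjection A) (hAρ : Commute A ρ) (hH : H.IsHermitian) (hHρ : Commute H ρ)
    (hmax : ∀ Q, IsStarProjection Q → Commute Q ρ → traceRe ρ (Q * H) ≤ traceRe ρ (A * H)) :
    Commute A H := by
  obtain ⟨Q, hQ, hQc, hp, hn⟩ := exists_positive_spectral_projection hH
  have hQρ : Commute Q ρ := (hQc ρ hHρ.symm).symm
  have h1 := hmax Q hQ hQρ
  have h2 := traceRe_projection_mul_nonneg hρ.posSemidef hA.one_sub
    ((Commute.one_left _).sub_left hAρ) hp
  have h3 := traceRe_projection_mul_nonneg hρ.posSemidef hA hAρ hn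
  -- Put `H₊ = Q H` and `H₋ = -(1 - Q) H`. Both terms on the right are nonnegative and maximality
  -- makes their sum at most zero, so faithfulness gives `(1 - A) H₊ = 0` and `A H₋ = 0`.
  have h4 : traceRe ρ (Q * H) - traceRe ρ (A * H) =
      traceRe ρ ((1 - A) * (Q * H)) + traceRe ρ (A * -((1 - Q) * H)) := by
    rw [← map_sub, ← map_add]
    congr 1
    noncomm_ring
  have h5 := projection_mul_eq_zero_of_traceRe hρ hA.one_sub
    ((Commute.one_left _).sub_left hAρ) hp (by linarith)
  have h6 := projection_mul_eq_zero_of_traceRe hρ hA hAρ hn (by linarith)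
  have hAs : Aᴴ = A := hA.isSelfAdjoint
  have h5' : (Q * H) * (1 - A) = 0 := by
    have := congrArg Matrix.conjTranspose h5
    rwa [Matrix.conjTranspose_mul, hp.isHermitian.eq, Matrix.conjTranspose_sub,
      Matrix.conjTranspose_one, hAs, Matrix.conjTranspose_zero] at this
  have h6' : -((1 - Q) * H) * A = 0 := by
    have := congrArg Matrix.conjTranspose h6
    rwa [Matrix.conjTranspose_mul, hn.isHermitian.eq, hAs, Matrix.conjTranspose_zero] at this
  -- Hence both `A H` and `H A` equal `H₊`.
  have e1 : A * H = Q * H - (1 - A) * (Q * H) - A * -((1 - Q) * H) := by noncomm_ring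
  have e2 : H * A = Q * H - (Q * H) * (1 - A) - -((1 - Q) * H) * A := by noncomm_ring
  rw [Commute, SemiconjBy, e1, e2, h5, h6, h5', h6']

end TracialStates

/-- The indicator `0` or `1` of a truth value. -/
def bitVal (b : Bool) : ℝ := if b then 1 else 0

theorem sum_fin_three_bool {M : Type*} [AddCommMonoid M] (f : (Fin 3 → Bool) → M) :
    ∑ e, f e = f ![true, true, true] + f ![true, true, false] + f ![true, false, true] +
      f ![true, false, false] + f ![false, true, true] + f ![false, true, false] +
      f ![false, false, true] + f ![false, false, false] := by
  rw [show (Finset.univ : Finset (Fin 3 → Bool)) = {![true, true, true], ![true, true, false],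
    ![true, false, true], ![true, false, false], ![false, true, true], ![false, true, false],
    ![false, false, true], ![false, false, false]} by decide]
  repeat rw [Finset.sum_insert (by decide)]
  rw [Finset.sum_singleton]
  simp only [add_assoc]

/-- The matrices `(τ(P_x P_y))` of convex combinations of deterministic triples of projections
(with weights `lam`) and triples of rank-one projections on `ℂ²` (with total weight `m`). -/
def tracialModel : Set (Fin 3 → Fin 3 → ℝ) :=
  {q | ∃ (lam : (Fin 3 → Bool) → ℝ) (m : ℝ) (G : Matrix (Fin 3) (Fin 3) ℝ),
    (∀ e, 0 ≤ lam e) ∧ G.PosSemidef ∧ (∀ x, G x x = m) ∧ ∑ e, lam e + m = 1 ∧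
    ∀ x y, q x y = ∑ e, lam e * (bitVal (e x) * bitVal (e y)) + (m + G x y) / 4}

/-! ### Splitting a triple into a commuting part and a traceless part -/

section TracialStates

open scoped ComplexOrder

variable {d : Type*} [Fintype d] [DecidableEq d]

/-- The quadratic form at `z` is the value of the functional at `Q Z²` with `Z = ∑ z_x U_x`. -/
theorem gram_posSemidef {ρ Q : Matrix d d ℂ} (hρ : ρ.PosSemidef) (hQ : IsStarProjection Q)
    (hc : Commute Q ρ) {n : ℕ} {U : Fin n → Matrix d d ℂ} (hU : ∀ x, (U x)ᴴ = U x) :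
    (Matrix.of fun x y => traceRe ρ (Q * (U x * U y))).PosSemidef := by
  refine Matrix.PosSemidef.of_dotProduct_mulVec_nonneg ?_ fun z => ?_
  · ext x y
    simpa using traceRe_mul_symm hρ.isHermitian hQ.isSelfAdjoint hc (hU y) (hU x)
  · set Z : Matrix d d ℂ := ∑ x, z x • U x with hZ
    have hZs : Zᴴ = Z := by
      simp [hZ, Matrix.conjTranspose_sum, Matrix.conjTranspose_smul, hU]
    have h := traceRe_projection_mul_nonneg hρ hQ hc (Matrix.posSemidef_conjTranspose_mul_self Z)
    rw [hZs] at h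
    refine h.trans_eq (Eq.symm ?_)
    simp only [hZ, Finset.sum_mul, Finset.mul_sum, map_sum, dotProduct, Matrix.mulVec,
      Matrix.of_apply, smul_mul_assoc, mul_smul_comm, map_smul, smul_eq_mul, star_trivial]
    rw [Finset.sum_comm]
    refine Finset.sum_congr rfl fun y _ => Finset.sum_congr rfl fun x _ => ?_
    rw [← traceRe_mul_symm hρ.isHermitian hQ.isSelfAdjoint hc (hU y) (hU x)]
    ring

/-- If all commutators of three projections are multiples of one matrix which anticommutes with
the associated symmetries, then the projections split into a commuting part and a part on which
the symmetries are traceless. -/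
theorem mem_tracialModel_of_commutators {ρ K : Matrix d d ℂ} (hρ : ρ.PosSemidef)
    (hρ1 : ρ.trace = 1) {P : Fin 3 → Matrix d d ℂ} (hP : ∀ x, IsStarProjection (P x))
    (hPρ : ∀ x, Commute (P x) ρ) (hK : Kᴴ = -K) (hKρ : Commute K ρ)
    (hKP : ∀ x, (2 • P x - 1) * K = -(K * (2 • P x - 1)))
    (hPP : ∀ x y, ∃ t : ℝ, P x * P y - P y * P x = t • K) :
    (fun x y => traceRe ρ (P x * P y)) ∈ tracialModel := by
  set U : Fin 3 → Matrix d d ℂ := fun x => 2 • P x - 1 with hU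
  have hPs : ∀ x, (P x)ᴴ = P x := fun x => (hP x).isSelfAdjoint
  have hPi : ∀ x, P x * P x = P x := fun x => (hP x).isIdempotentElem
  have hUs : ∀ x, (U x)ᴴ = U x := fun x => by simp [hU, two_smul, hPs]
  have hU2 : ∀ x, U x * U x = 1 := fun x => by
    have : U x * U x = 4 • (P x * P x) - 4 • P x + 1 := by simp only [hU]; noncomm_ring
    rw [this, hPi]; simp
  have hUρ : ∀ x, Commute (U x) ρ := fun x =>
    ((hPρ x).smul_left 2).sub_left (Commute.one_left _)
  have hKU : ∀ x, U x * K = -(K * U x) := hKP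
  -- `Q` projects onto the kernel of `Kᴴ K = -K²`. Each `U x` anticommutes with `K`, hence commutes
  -- with `K²` and with `Q`.
  obtain ⟨Q, R, hQ, hQc, hRc, hKQ, hQR⟩ :=
    exists_kernel_projection (Matrix.isHermitian_conjTranspose_mul_self K)
  have hN : Kᴴ * K = -(K * K) := by rw [hK, neg_mul]
  rw [hN] at hQc hRc hKQ hQR
  have hNU : ∀ x, Commute (U x) (-(K * K)) := fun x => by
    refine Commute.neg_right ?_
    rw [Commute, SemiconjBy, ← mul_assoc, hKU, neg_mul, mul_assoc, hKU, mul_neg, neg_neg,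
      mul_assoc]
  have hNK : Commute K (-(K * K)) := ((Commute.refl K).mul_right (Commute.refl K)).neg_right
  have hNρ : Commute ρ (-(K * K)) := (hKρ.symm.mul_right hKρ.symm).neg_right
  have hUP : ∀ x, P x = (2⁻¹ : ℝ) • (1 + U x) := fun x => by
    simp only [hU]
    rw [add_sub_cancel, ← Nat.cast_smul_eq_nsmul ℝ, smul_smul]
    norm_num
  have hQP : ∀ x, Commute Q (P x) := fun x => by
    rw [hUP]
    exact ((Commute.one_right _).add_right (hQc _ (hNU x)).symm).smul_right _
  have hQρ : Commute Q ρ := (hQc _ hNρ).symm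
  have hQs : Qᴴ = Q := hQ.isSelfAdjoint
  have hQi : Q * Q = Q := hQ.isIdempotentElem
  have hKQ0 : K * Q = 0 := by
    have h : (K * Q)ᴴ * (K * Q) = 0 := by
      rw [Matrix.conjTranspose_mul, hK, hQs]
      calc Q * -K * (K * Q) = Q * (-(K * K) * Q) := by noncomm_ring
        _ = 0 := by rw [hKQ, mul_zero]
    exact Matrix.conjTranspose_mul_self_eq_zero.1 h
  have hQcomm : ∀ x y, Q * P x * (Q * P y) = Q * P y * (Q * P x) := fun x y => by
    have e : ∀ x y, Q * P x * (Q * P y) = P x * P y * Q := fun x y => by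
      calc Q * P x * (Q * P y) = (Q * P x) * (Q * P y) := rfl
        _ = (P x * Q) * (P y * Q) := by rw [(hQP x).eq, (hQP y).eq]
        _ = P x * (Q * P y) * Q := by simp only [mul_assoc]
        _ = P x * P y * (Q * Q) := by rw [(hQP y).eq]; simp only [mul_assoc]
        _ = _ := by rw [hQi]
    obtain ⟨t, ht⟩ := hPP x y
    rw [e, e, ← sub_eq_zero, ← sub_mul, ht, smul_mul_assoc, hKQ0, smul_zero]
  have hn : IsStarProjection (1 - Q) := hQ.one_sub
  have hnρ : Commute (1 - Q) ρ := (Commute.one_left _).sub_left hQρ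
  -- Since `1 - Q = -K² R`, one factor `K` can be moved cyclically around the trace; passing `U x`
  -- changes the sign, so the trace equals its own negative.
  have hnU : ∀ x, traceRe ρ ((1 - Q) * U x) = 0 := fun x => by
    have hRK : R * K = K * R := ((hRc K hNK).eq).symm
    have hRU : R * U x = U x * R := ((hRc _ (hNU x)).eq).symm
    have hRρ : R * ρ = ρ * R := ((hRc _ hNρ).eq).symm
    have h1 : (ρ * (K * K * R * U x)).trace = -(ρ * (K * K * R * U x)).trace := by
      calc (ρ * (K * K * R * U x)).trace = (K * ((K * R * U x) * ρ)).trace := by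
            rw [Matrix.trace_mul_comm]; simp only [mul_assoc]
        _ = ((K * R * U x) * (ρ * K)).trace := by
            rw [Matrix.trace_mul_comm]; simp only [mul_assoc]
        _ = ((K * R) * (U x * K) * ρ).trace := by
            rw [← hKρ.eq]; simp only [mul_assoc]
        _ = -(K * (R * K) * U x * ρ).trace := by
            rw [hKU, ← Matrix.trace_neg]
            congr 1
            noncomm_ring
        _ = _ := by
            rw [hRK, Matrix.trace_mul_comm]
            simp only [mul_assoc]
    have h2 : (ρ * (K * K * R * U x)).trace = 0 := by
      linear_combination (1 / 2 : ℂ) * h1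
    rw [traceRe_apply, hQR]
    have h3 : ρ * (-(K * K) * R * U x) = -(ρ * (K * K * R * U x)) := by noncomm_ring
    rw [h3, Matrix.trace_neg, h2]
    simp
  set pr : (Fin 3 → Bool) → Fin 3 → Matrix d d ℂ :=
    fun e x => if e x then P x else 1 - P x with hpr
  have hpr1 : ∀ e x, IsStarProjection (pr e x) := fun e x => by
    simp only [hpr]; split_ifs
    exacts [hP x, (hP x).one_sub]
  have hprQ : ∀ e x, Commute Q (pr e x) := fun e x => by
    simp only [hpr]; split_ifs
    exacts [hQP x, (Commute.one_right _).sub_right (hQP x)]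
  have hprρ : ∀ e x, Commute (pr e x) ρ := fun e x => by
    simp only [hpr]; split_ifs
    exacts [hPρ x, (Commute.one_left _).sub_left (hPρ x)]
  have hprc : ∀ e x y, Commute (Q * pr e x) (Q * pr e y) := fun e x y => by
    have h1 : Commute (Q * P x) (Q * P y) := hQcomm x y
    have h2 : ∀ z, Commute (Q * P z) Q := fun z => by
      rw [Commute, SemiconjBy, (hQP z).eq, mul_assoc, ← mul_assoc Q, hQi, (hQP z).eq, mul_assoc,
        hQi]
    simp only [hpr]; split_ifs
    · exact h1
    · rw [mul_sub, mul_one]; exact (h2 x).sub_right h1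
    · rw [mul_sub, mul_one]; exact (h2 y).symm.sub_left h1
    · rw [mul_sub, mul_one, mul_sub, mul_one]
      exact ((Commute.refl _).sub_right (h2 y).symm).sub_left ((h2 x).sub_right h1)
  have hprp : ∀ e x, IsStarProjection (Q * pr e x) := fun e x => hQ.mul (hpr1 e x) (hprQ e x)
  -- The joint distribution of the projections, which commute after compression by `Q`.
  set lam : (Fin 3 → Bool) → ℝ := fun e => traceRe ρ (Q * (pr e 0 * pr e 1 * pr e 2)) with hlam
  have hlam0 : ∀ e, 0 ≤ lam e := fun e => by
    have hmul : ∀ A B, Commute Q A → Q * A * (Q * B) = Q * (A * B) := fun A B hA => by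
      rw [mul_assoc, ← mul_assoc A, ← hA.eq, mul_assoc, ← mul_assoc Q Q, hQi]
    have h1 : Q * (pr e 0 * pr e 1 * pr e 2) = (Q * pr e 0) * (Q * pr e 1) * (Q * pr e 2) := by
      rw [hmul _ _ (hprQ e 0), hmul _ _ ((hprQ e 0).mul_right (hprQ e 1))]
    simp only [hlam]
    rw [h1]
    refine traceRe_projection_nonneg hρ (((hprp e 0).mul (hprp e 1) (hprc e 0 1)).mul (hprp e 2)
      ((hprc e 0 2).mul_left (hprc e 1 2))) ?_
    exact ((hQρ.mul_left (hprρ e 0)).mul_left (hQρ.mul_left (hprρ e 1))).mul_left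
      (hQρ.mul_left (hprρ e 2))
  have hsymm : ∀ x y, traceRe ρ (P x * P y) = traceRe ρ (P y * P x) := fun x y => by
    simpa using traceRe_mul_symm hρ.isHermitian (Q := 1) (by simp) (Commute.one_left _)
      (hPs x) (hPs y)
  have hG := gram_posSemidef hρ hn hnρ hUs
  have htot : traceRe ρ (1 : Matrix d d ℂ) = 1 := by simp [traceRe_apply, hρ1]
  -- The weights use products in the order `0, 1, 2`, so ordered pairs reduce directly; the other
  -- pairs follow by symmetry of the trace. On `1 - Q` the identity `4 P_x P_y = (1 + U_x)(1 + U_y)`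
  -- is expanded and the linear terms vanish.
  have hupper : ∀ x y, x ≤ y → traceRe ρ (P x * P y) =
      ∑ e, lam e * (bitVal (e x) * bitVal (e y)) +
        (traceRe ρ (1 - Q) + traceRe ρ ((1 - Q) * (U x * U y))) / 4 := fun x y hxy => by
    have h1 : P x * P y = Q * (P x * P y) + (4⁻¹ : ℝ) • ((1 - Q) + (1 - Q) * U x + (1 - Q) * U y +
        (1 - Q) * (U x * U y)) := by
      have e : (1 - Q) + (1 - Q) * U x + (1 - Q) * U y + (1 - Q) * (U x * U y) =
          4 • ((1 - Q) * (P x * P y)) := by simp only [hU]; noncomm_ring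
      rw [e, ← Nat.cast_smul_eq_nsmul ℝ, smul_smul]
      norm_num
      noncomm_ring
    have h2 : traceRe ρ (Q * (P x * P y)) = ∑ e, lam e * (bitVal (e x) * bitVal (e y)) := by
      rw [sum_fin_three_bool]
      fin_cases x <;> fin_cases y <;> first | (exact absurd hxy (by decide)) |
        (simp [hlam, hpr, bitVal, mul_sub, sub_mul, mul_assoc, hPi])
    rw [h1, map_add, h2, map_smul, map_add, map_add, map_add, hnU, hnU, smul_eq_mul]
    ring
  refine ⟨lam, traceRe ρ (1 - Q), _, hlam0, hG, fun x => ?_, ?_, fun x y => ?_⟩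
  · simp [hU2]
  · rw [map_sub, htot]
    have : ∑ e, lam e = traceRe ρ Q := by
      rw [sum_fin_three_bool]
      simp [hlam, hpr, mul_sub, sub_mul, mul_assoc]
    rw [this]; ring
  · rcases le_total x y with h | h
    · exact hupper x y h
    · beta_reduce
      rw [hsymm, hupper y x h, Matrix.of_apply,
        traceRe_mul_symm hρ.isHermitian hn.isSelfAdjoint hnρ (hUs y) (hUs x)]
      congr 1
      exact Finset.sum_congr rfl fun e _ => by ring

end TracialStates

/-! ### Convexity and compactness of the model -/

section Model

theorem convex_tracialModel : Convex ℝ tracialModel := by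
  rintro p ⟨l, m, G, hl, hG, hm, hs, hp⟩ q ⟨l', m', G', hl', hG', hm', hs', hq⟩ a b ha hb hab
  refine ⟨fun e => a * l e + b * l' e, a * m + b * m', a • G + b • G', fun e => ?_,
    (hG.smul ha).add (hG'.smul hb), fun x => by simp [hm, hm'], ?_, fun x y => ?_⟩
  · have := hl e; have := hl' e; positivity
  · rw [Finset.sum_add_distrib, ← Finset.mul_sum, ← Finset.mul_sum]
    linear_combination a * hs + b * hs' + hab
  · simp only [Pi.add_apply, Pi.smul_apply, smul_eq_mul, hp, hq, Matrix.add_apply,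
      Matrix.smul_apply, add_mul, Finset.sum_add_distrib, mul_assoc, ← Finset.mul_sum]
    ring

/-- The quadratic form at `e_x ± e_y` is `2 m ± 2 G x y`. This bounds the Gram part in the
compactness proof and forces it to vanish when `m = 0`. -/
theorem abs_apply_le_of_posSemidef {n : ℕ} {G : Matrix (Fin n) (Fin n) ℝ} (hG : G.PosSemidef)
    {m : ℝ} (hm : ∀ x, G x x = m) (x y : Fin n) : |G x y| ≤ m := by
  have hs : G y x = G x y := by simpa using hG.isHermitian.apply x y
  have h : ∀ s : ℝ, 0 ≤ m + s * G x y + (s * G x y + s * s * m) := fun s => by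
    have h := hG.dotProduct_mulVec_nonneg (Pi.single x 1 + Pi.single y s)
    simp only [star_trivial, Matrix.mulVec_add, dotProduct_add, add_dotProduct,
      Matrix.mulVec_single] at h
    simp [hm, hs] at h
    linarith
  rw [abs_le]
  constructor
  · linarith [h 1]
  · linarith [h (-1)]

theorem isClosed_setOf_posSemidef (n : ℕ) :
    IsClosed {G : Fin n → Fin n → ℝ | (Matrix.of G).PosSemidef} := by
  have h : {G : Fin n → Fin n → ℝ | (Matrix.of G).PosSemidef} =
      {G | (Matrix.of G)ᴴ = Matrix.of G} ∩
        ⋂ z : Fin n → ℝ, {G | 0 ≤ star z ⬝ᵥ (Matrix.of G *ᵥ z)} := by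
    ext G
    simp only [Set.mem_ofPred_eq, Set.mem_inter_iff, Set.mem_iInter,
      Matrix.posSemidef_iff_dotProduct_mulVec, Matrix.IsHermitian]
  have hc : Continuous fun G : Fin n → Fin n → ℝ => (Matrix.of G : Matrix (Fin n) (Fin n) ℝ) :=
    continuous_id
  rw [h]
  refine (isClosed_eq hc.matrix_conjTranspose hc).inter (isClosed_iInter fun z => ?_)
  exact isClosed_le continuous_const (Continuous.dotProduct continuous_const
    (hc.matrix_mulVec continuous_const))

theorem isCompact_tracialModel : IsCompact tracialModel := by
  set S : Set (((Fin 3 → Bool) → ℝ) × ℝ × (Fin 3 → Fin 3 → ℝ)) :=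
    {t | (∀ e, 0 ≤ t.1 e) ∧ (Matrix.of t.2.2).PosSemidef ∧ (∀ x, t.2.2 x x = t.2.1) ∧
      ∑ e, t.1 e + t.2.1 = 1} with hS
  have hSc : IsCompact S := by
    refine IsCompact.of_isClosed_subset (s := (Set.univ.pi fun _ => Set.Icc 0 1) ×ˢ
      (Set.Icc 0 1 : Set ℝ) ×ˢ (Set.univ.pi fun _ => Set.univ.pi fun _ => Set.Icc (-1) 1)) ?_ ?_ ?_
    · exact (isCompact_univ_pi fun _ => isCompact_Icc).prod (isCompact_Icc.prod
        (isCompact_univ_pi fun _ => isCompact_univ_pi fun _ => isCompact_Icc))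
    · simp only [hS, Set.ofPred_and, Set.ofPred_forall]
      refine (isClosed_iInter fun e => ?_).inter (IsClosed.inter ?_ ((isClosed_iInter
        fun x => ?_).inter ?_))
      · exact isClosed_le continuous_const (by fun_prop)
      · exact (isClosed_setOf_posSemidef 3).preimage (by fun_prop)
      · exact isClosed_eq (by fun_prop) (by fun_prop)
      · exact isClosed_eq (by fun_prop) (by fun_prop)
    · rintro ⟨l, m, G⟩ ⟨hl, hG, hm, hs⟩
      simp only at hl hG hm hs
      have hm0 : 0 ≤ m := by rw [← hm 0]; exact hG.diag_nonneg (i := 0)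
      have hle : ∀ e, l e ≤ 1 := fun e => by
        have := Finset.single_le_sum (f := l) (fun e _ => hl e) (Finset.mem_univ e)
        linarith
      have hm1 : m ≤ 1 := by
        have := Finset.sum_nonneg (s := Finset.univ) (f := l) (fun e _ => hl e)
        linarith
      refine ⟨fun e _ => ⟨hl e, hle e⟩, ⟨hm0, hm1⟩, fun x _ y _ => ?_⟩
      exact abs_le.1 ((abs_apply_le_of_posSemidef hG hm x y).trans hm1)
  convert hSc.image (f := fun t x y => ∑ e, t.1 e * (bitVal (e x) * bitVal (e y)) +
    (t.2.1 + t.2.2 x y) / 4) (by fun_prop) using 1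
  ext q
  constructor
  · rintro ⟨l, m, G, hl, hG, hm, hs, hq⟩
    exact ⟨(l, m, G), ⟨hl, hG, hm, hs⟩, by ext x y; exact (hq x y).symm⟩
  · rintro ⟨⟨l, m, G⟩, ⟨hl, hG, hm, hs⟩, rfl⟩
    exact ⟨l, m, G, hl, hG, hm, hs, fun x y => rfl⟩

end Model

/-! ### Triples of projections that maximize a generic functional -/

section Extremal

open scoped ComplexOrder

variable {d : Type*} [Fintype d] [DecidableEq d]

theorem norm_apply_le_of_isStarProjection {A : Matrix d d ℂ} (hA : IsStarProjection A) (i j : d) :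
    ‖A i j‖ ≤ 1 := by
  have hs : Aᴴ = A := hA.isSelfAdjoint
  have h1 : ∀ i, (A i i).re = ∑ j, ‖A i j‖ ^ 2 := fun i => by
    have h : (A * Aᴴ) i i = A i i := by rw [hs]; exact congrFun₂ hA.isIdempotentElem i i
    rw [← h, Matrix.mul_apply, Complex.re_sum]
    refine Finset.sum_congr rfl fun j _ => ?_
    rw [Matrix.conjTranspose_apply, Complex.star_def, Complex.mul_conj, Complex.ofReal_re,
      Complex.normSq_eq_norm_sq]
  have h2 : ∀ i j, ‖A i j‖ ^ 2 ≤ (A i i).re := fun i j => by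
    rw [h1]
    exact Finset.single_le_sum (f := fun j => ‖A i j‖ ^ 2) (fun _ _ => by positivity)
      (Finset.mem_univ j)
  have h3 : (A i i).re ≤ 1 := by
    have h4 := h2 i i
    have h5 : (A i i).re ^ 2 ≤ ‖A i i‖ ^ 2 := by
      rw [← sq_abs]
      exact pow_le_pow_left₀ (abs_nonneg _) (Complex.abs_re_le_norm _) 2
    nlinarith
  have := h2 i j
  nlinarith [norm_nonneg (A i j)]

theorem isCompact_setOf_isStarProjection (ρ : Matrix d d ℂ) :
    IsCompact {A : Matrix d d ℂ | IsStarProjection A ∧ Commute A ρ} := by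
  refine IsCompact.of_isClosed_subset
    (s := (Set.univ.pi fun _ => Set.univ.pi fun _ => Metric.closedBall 0 1 : Set (d → d → ℂ)))
    (isCompact_univ_pi fun _ => isCompact_univ_pi fun _ => isCompact_closedBall _ _) ?_ ?_
  · have h : {A : Matrix d d ℂ | IsStarProjection A ∧ Commute A ρ} =
        {A | A * A = A} ∩ {A | star A = A} ∩ {A | A * ρ = ρ * A} := by
      ext A
      simp [isStarProjection_iff, IsIdempotentElem, IsSelfAdjoint, Commute, SemiconjBy]
    rw [h]
    exact ((isClosed_eq (by fun_prop) (by fun_prop)).inter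
      (isClosed_eq (by fun_prop) (by fun_prop))).inter (isClosed_eq (by fun_prop) (by fun_prop))
  · rintro A ⟨hA, -⟩ i - j -
    simpa using norm_apply_le_of_isStarProjection hA i j

/-- A commutator with `A` is off-diagonal for the decomposition given by `A` and `1 - A`. -/
theorem symmetry_anticommute_commutator {A B : Matrix d d ℂ} (hA : A * A = A) :
    (2 • A - 1) * (A * B - B * A) = -((A * B - B * A) * (2 • A - 1)) := by
  have e1 : (2 • A - 1) * (A * B - B * A) =
      2 • (A * A * B) - 2 • (A * B * A) - A * B + B * A := by noncomm_ring
  have e2 : (A * B - B * A) * (2 • A - 1) =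
      2 • (A * B * A) - 2 • (B * (A * A)) - A * B + B * A := by noncomm_ring
  rw [e1, e2, hA]
  noncomm_ring

theorem symmetry_anticommute_smul {A K L : Matrix d d ℂ} {t : ℝ}
    (h : (2 • A - 1) * L = -(L * (2 • A - 1))) (hK : K = t • L) :
    (2 • A - 1) * K = -(K * (2 • A - 1)) := by
  rw [hK, mul_smul_comm, h, smul_neg, smul_mul_assoc]

theorem continuous_traceRe (ρ : Matrix d d ℂ) : Continuous (traceRe ρ) :=
  Complex.continuous_re.comp (Continuous.matrix_trace (continuous_const.matrix_mul continuous_id))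

/-- A generic linear functional on the correlations of triples of projections is bounded by a
value on the model. -/
theorem exists_mem_tracialModel_ge {ρ : Matrix d d ℂ} (hρ : ρ.PosDef) (hρ1 : ρ.trace = 1)
    {P : Fin 3 → Matrix d d ℂ} (hP : ∀ x, IsStarProjection (P x)) (hPρ : ∀ x, Commute (P x) ρ)
    {F : Fin 3 → Fin 3 → ℝ} (hF : ∀ x y, x ≠ y → F x y + F y x ≠ 0) :
    ∃ q ∈ tracialModel, ∑ x, ∑ y, F x y * traceRe ρ (P x * P y) ≤ ∑ x, ∑ y, F x y * q x y := by
  set s : Set (Matrix d d ℂ) := {A | IsStarProjection A ∧ Commute A ρ} with hs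
  have hcs : IsCompact s := isCompact_setOf_isStarProjection ρ
  set S : Set (Fin 3 → Matrix d d ℂ) := Set.univ.pi fun _ => s with hS
  have hcS : IsCompact S := isCompact_univ_pi fun _ => hcs
  have hPS : P ∈ S := fun x _ => ⟨hP x, hPρ x⟩
  obtain ⟨T, hT, hmax⟩ := hcS.exists_isMaxOn ⟨P, hPS⟩
    (f := fun T => ∑ x, ∑ y, F x y * traceRe ρ (T x * T y))
    (by
      have := continuous_traceRe ρ
      exact (continuous_finsetSum _ fun x _ => continuous_finsetSum _ fun y _ =>
        continuous_const.mul (this.comp ((continuous_apply x).mul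
          (continuous_apply y)))).continuousOn)
  refine ⟨fun x y => traceRe ρ (T x * T y), ?_, hmax hPS⟩
  have hTp : ∀ x, IsStarProjection (T x) := fun x => (hT x trivial).1
  have hTρ : ∀ x, Commute (T x) ρ := fun x => (hT x trivial).2
  have hTs : ∀ x, (T x)ᴴ = T x := fun x => (hTp x).isSelfAdjoint
  have hTi : ∀ x, T x * T x = T x := fun x => (hTp x).isIdempotentElem
  -- With the other two projections fixed, the functional is affine in `T x`, because `T x * T x = T
  -- x`; this is its coefficient.
  have hcomm : ∀ x, Commute (T x) (F x x • 1 + ∑ y ∈ Finset.univ.erase x,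
      (F x y + F y x) • T y) := fun x => by
    refine commute_of_traceRe_isMax hρ (hTp x) (hTρ x) ?_ ?_ fun Q hQ hQρ => ?_
    · refine Matrix.IsHermitian.add ?_ ?_
      · simp [Matrix.IsHermitian, Matrix.conjTranspose_smul]
      · simp [Matrix.IsHermitian, Matrix.conjTranspose_sum, Matrix.conjTranspose_smul, hTs]
    · exact ((Commute.one_left _).smul_left _).add_left
        (Commute.sum_left _ _ _ fun y _ => (hTρ y).smul_left _)
    · have h := hmax (a := Function.update T x Q) (fun y _ => by
        by_cases hy : y = x
        · subst hy; simpa using ⟨hQ, hQρ⟩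
        · simpa [hy] using ⟨hTp y, hTρ y⟩)
      have hQi : Q * Q = Q := hQ.isIdempotentElem
      have hsw : ∀ y, traceRe ρ (T y * Q) = traceRe ρ (Q * T y) := fun y => by
        simpa using traceRe_mul_symm hρ.isHermitian (Q := 1) (by simp) (Commute.one_left _)
          (hTs y) (hQ.isSelfAdjoint)
      have hsw' : ∀ y z, traceRe ρ (T y * T z) = traceRe ρ (T z * T y) := fun y z => by
        simpa using traceRe_mul_symm hρ.isHermitian (Q := 1) (by simp) (Commute.one_left _)
          (hTs y) (hTs z)
      have e0 : Finset.univ.erase (0 : Fin 3) = {1, 2} := by decide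
      have e1 : Finset.univ.erase (1 : Fin 3) = {0, 2} := by decide
      have e2 : Finset.univ.erase (2 : Fin 3) = {0, 1} := by decide
      simp only [Set.mem_ofPred_eq] at h
      have h01 := hsw' 1 0
      have h02 := hsw' 2 0
      have h12 := hsw' 2 1
      fin_cases x
      · simp [Fin.sum_univ_three, hQi, hTi, hsw] at h
        simp [e0, mul_add]
        simp only [h01, h02, h12] at h ⊢
        linarith
      · simp [Fin.sum_univ_three, hQi, hTi, hsw] at h
        simp [e1, mul_add]
        simp only [h01, h02, h12] at h ⊢
        linarith
      · simp [Fin.sum_univ_three, hQi, hTi, hsw] at h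
        simp [e2, mul_add]
        simp only [h01, h02, h12] at h ⊢
        linarith
  have hbr : ∀ x, ∑ y ∈ Finset.univ.erase x, (F x y + F y x) • (T x * T y - T y * T x) = 0 :=
    fun x => by
    have h := (hcomm x).eq
    simp only [mul_add, add_mul, Finset.mul_sum, Finset.sum_mul, mul_smul_comm, smul_mul_assoc,
      mul_one, one_mul, add_right_inj] at h
    simp only [smul_sub, Finset.sum_sub_distrib, h, sub_self]
  have e0 : Finset.univ.erase (0 : Fin 3) = {1, 2} := by decide
  have e1 : Finset.univ.erase (1 : Fin 3) = {0, 2} := by decide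
  have hb0 := hbr 0
  have hb1 := hbr 1
  rw [e0, Finset.sum_pair (by decide)] at hb0
  rw [e1, Finset.sum_pair (by decide)] at hb1
  set a := F 0 1 + F 1 0 with ha
  set b := F 0 2 + F 2 0 with hb
  set c := F 1 2 + F 2 1 with hc
  have ha0 : a ≠ 0 := hF 0 1 (by decide)
  have hb0' : b ≠ 0 := hF 0 2 (by decide)
  have hc0 : c ≠ 0 := hF 1 2 (by decide)
  -- The relations for `x = 0, 1` express the other two commutators as multiples of `K`; genericity
  -- of `F` permits the divisions.
  set K := T 0 * T 1 - T 1 * T 0 with hK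
  have hK10 : T 1 * T 0 - T 0 * T 1 = (-1 : ℝ) • K := by rw [hK]; simp
  have hK02 : T 0 * T 2 - T 2 * T 0 = (-(a / b)) • K := by
    have : b • (T 0 * T 2 - T 2 * T 0) = -(a • K) := by
      rw [eq_neg_iff_add_eq_zero, add_comm]; exact hb0
    calc _ = b⁻¹ • (b • (T 0 * T 2 - T 2 * T 0)) := by rw [smul_smul, inv_mul_cancel₀ hb0', one_smul]
      _ = _ := by rw [this, smul_neg, smul_smul, ← neg_smul]; congr 1; field_simp
  have hK12 : T 1 * T 2 - T 2 * T 1 = (a / c) • K := by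
    have : c • (T 1 * T 2 - T 2 * T 1) = a • K := by
      have h : F 1 0 + F 0 1 = a := add_comm _ _
      rw [h, hK10, smul_smul, mul_neg_one, neg_smul] at hb1
      rw [← sub_eq_zero, sub_eq_neg_add]; exact hb1
    calc _ = c⁻¹ • (c • (T 1 * T 2 - T 2 * T 1)) := by rw [smul_smul, inv_mul_cancel₀ hc0, one_smul]
      _ = _ := by rw [this, smul_smul]; congr 1; field_simp
  refine mem_tracialModel_of_commutators (K := K) hρ.posSemidef hρ1 hTp hTρ ?_ ?_ ?_ ?_
  · simp [hK, hTs]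
  · exact ((hTρ 0).mul_left (hTρ 1)).sub_left ((hTρ 1).mul_left (hTρ 0))
  · intro x
    fin_cases x
    · exact symmetry_anticommute_commutator (hTi 0)
    · refine symmetry_anticommute_smul (t := -1)
        (symmetry_anticommute_commutator (B := T 0) (hTi 1)) ?_
      change K = (-1 : ℝ) • (T 1 * T 0 - T 0 * T 1)
      rw [hK10, smul_smul]; simp
    · refine symmetry_anticommute_smul (t := b / a)
        (symmetry_anticommute_commutator (B := T 0) (hTi 2)) ?_
      change K = (b / a) • (T 2 * T 0 - T 0 * T 2)
      rw [← neg_sub, hK02, ← neg_smul, smul_smul, neg_neg, div_mul_div_cancel₀ ha0, div_self hb0',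
        one_smul]
  · have hflip : ∀ x y (t : ℝ), T x * T y - T y * T x = t • K →
        T y * T x - T x * T y = (-t) • K := fun x y t h => by
      rw [← neg_sub, h, neg_smul]
    intro x y
    fin_cases x <;> fin_cases y
    · exact ⟨0, by simp⟩
    · exact ⟨1, by simp [hK]⟩
    · exact ⟨_, hK02⟩
    · exact ⟨_, hK10⟩
    · exact ⟨0, by simp⟩
    · exact ⟨_, hK12⟩
    · exact ⟨_, hflip _ _ _ hK02⟩
    · exact ⟨_, hflip _ _ _ hK12⟩
    · exact ⟨0, by simp⟩

end Extremal

/-! ### Every tracial triple lies in the model -/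

section TracialStates

open scoped ComplexOrder
open Filter Topology

variable {d : Type*} [Fintype d] [DecidableEq d]

theorem continuousLinearMap_apply_eq_sum (f : (Fin 3 → Fin 3 → ℝ) →L[ℝ] ℝ)
    (q : Fin 3 → Fin 3 → ℝ) :
    f q = ∑ x, ∑ y, f (Pi.single x (Pi.single y 1)) * q x y := by
  have h : q = ∑ x, ∑ y, q x y • (Pi.single x (Pi.single y 1) : Fin 3 → Fin 3 → ℝ) := by
    ext a b
    simp [Finset.sum_apply, Pi.single_apply, apply_ite, ite_apply]
  conv_lhs => rw [h]
  simp only [map_sum, map_smul, smul_eq_mul, mul_comm]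

theorem mem_tracialModel_of_posDef {ρ : Matrix d d ℂ} (hρ : ρ.PosDef) (hρ1 : ρ.trace = 1)
    {P : Fin 3 → Matrix d d ℂ} (hP : ∀ x, IsStarProjection (P x)) (hPρ : ∀ x, Commute (P x) ρ) :
    (fun x y => traceRe ρ (P x * P y)) ∈ tracialModel := by
  by_contra hq
  obtain ⟨f, u, hfu, huq⟩ := geometric_hahn_banach_closed_point convex_tracialModel
    isCompact_tracialModel.isClosed hq
  set q : Fin 3 → Fin 3 → ℝ := fun x y => traceRe ρ (P x * P y) with hqdef
  set F : Fin 3 → Fin 3 → ℝ := fun x y => f (Pi.single x (Pi.single y 1)) with hF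
  obtain ⟨B, hB⟩ := (isCompact_tracialModel.image
    (f := fun q : Fin 3 → Fin 3 → ℝ => ∑ x, ∑ y, q x y) (by fun_prop)).bddAbove
  -- A separating functional need not be generic, so all its coefficients are shifted by a small
  -- `ε`; compactness bounds the error on the model by `ε * B`.
  have hgen : ∀ᶠ ε : ℝ in 𝓝[>] 0, ∀ x y, (F x y + ε) + (F y x + ε) ≠ 0 := by
    refine eventually_all.2 fun x => eventually_all.2 fun y => ?_
    by_cases h : F x y + F y x = 0
    · filter_upwards [self_mem_nhdsWithin] with ε hε h'
      have : (0 : ℝ) < ε := hε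
      linarith
    · have hc : Continuous fun ε : ℝ => (F x y + ε) + (F y x + ε) := by fun_prop
      exact nhdsWithin_le_nhds ((hc.tendsto 0).eventually_ne (by simpa using h))
  have hle : ∀ᶠ ε : ℝ in 𝓝[>] 0, f q + ε * ∑ x, ∑ y, q x y ≤ u + ε * B := by
    filter_upwards [hgen, self_mem_nhdsWithin] with ε hε hε0
    have hε0 : (0 : ℝ) < ε := hε0
    obtain ⟨p, hp, hpq⟩ := exists_mem_tracialModel_ge hρ hρ1 hP hPρ
      (F := fun x y => F x y + ε) fun x y _ => hε x y
    simp only [add_mul, Finset.sum_add_distrib, ← Finset.mul_sum] at hpq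
    have h1 := continuousLinearMap_apply_eq_sum f q
    have h2 := continuousLinearMap_apply_eq_sum f p
    have h3 := hfu p hp
    have h4 : ∑ x, ∑ y, p x y ≤ B := hB ⟨p, hp, rfl⟩
    have h5 := mul_le_mul_of_nonneg_left h4 hε0.le
    simp only [hF] at hpq
    rw [h1]
    linarith
  have hc1 : Continuous fun ε : ℝ => f q + ε * ∑ x, ∑ y, q x y := by fun_prop
  have hc2 : Continuous fun ε : ℝ => u + ε * B := by fun_prop
  have := le_of_tendsto_of_tendsto ((hc1.tendsto 0).mono_left nhdsWithin_le_nhds)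
    ((hc2.tendsto 0).mono_left nhdsWithin_le_nhds) hle
  simp only [zero_mul, add_zero] at this
  exact absurd huq (not_lt.2 this)

/-- Mixing in the maximally mixed state makes `ρ` invertible while keeping it in the commutant of
the projections; the model is closed. -/
theorem mem_tracialModel_of_posSemidef {ρ : Matrix d d ℂ} (hρ : ρ.PosSemidef)
    (hρ1 : ρ.trace = 1) {P : Fin 3 → Matrix d d ℂ} (hP : ∀ x, IsStarProjection (P x))
    (hPρ : ∀ x, Commute (P x) ρ) :
    (fun x y => traceRe ρ (P x * P y)) ∈ tracialModel := by
  have hne : Nonempty d := by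
    by_contra h
    rw [not_nonempty_iff] at h
    simp [Matrix.trace] at hρ1
  have hcard : (Fintype.card d : ℝ) ≠ 0 := by simp
  set σ : Matrix d d ℂ := (Fintype.card d : ℝ)⁻¹ • 1 with hσ
  have hσ1 : σ.trace = 1 := by
    simp [hσ, Matrix.trace_smul]
  have hσp : σ.PosDef := Matrix.PosDef.one.smul (by positivity)
  set r : ℝ → Matrix d d ℂ := fun ε => (1 - ε) • ρ + ε • σ with hr
  have hlin : ∀ ε Z, traceRe (r ε) Z = (1 - ε) * traceRe ρ Z + ε * traceRe σ Z := fun ε Z => by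
    simp only [traceRe_apply, hr, add_mul, smul_mul_assoc, Matrix.trace_add, Matrix.trace_smul,
      Complex.add_re, Complex.smul_re, smul_eq_mul]
  have hcont : Continuous fun ε : ℝ => fun x y : Fin 3 => traceRe (r ε) (P x * P y) := by
    simp only [hlin]
    fun_prop
  have h0 : (fun x y => traceRe ρ (P x * P y)) = fun x y : Fin 3 => traceRe (r 0) (P x * P y) := by
    simp [hr]
  rw [h0]
  refine isCompact_tracialModel.isClosed.mem_of_tendsto
    ((hcont.tendsto 0).mono_left nhdsWithin_le_nhds : Tendsto _ (𝓝[>] (0 : ℝ)) _) ?_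
  filter_upwards [Ioo_mem_nhdsGT (zero_lt_one' ℝ)] with ε hε
  refine mem_tracialModel_of_posDef ?_ ?_ hP fun x => ?_
  · exact Matrix.PosDef.posSemidef_add (hρ.smul (sub_nonneg.2 hε.2.le)) (hσp.smul hε.1)
  · simp [hr, Matrix.trace_smul, hρ1, hσ1]
  · exact ((hPρ x).smul_right _).add_right (((Commute.one_right _).smul_right _).smul_right _)

end TracialStates

/-! ### Synchronous correlations and tracial states -/

section TracialForm

open scoped ComplexOrder

theorem IsStarProjection.matrix_transpose {d : Type*} [Fintype d] {A : Matrix d d ℂ}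
    (hA : IsStarProjection A) : IsStarProjection Aᵀ where
  isIdempotentElem := by
    rw [IsIdempotentElem, ← Matrix.transpose_mul, hA.isIdempotentElem.eq]
  isSelfAdjoint := by
    have h : Aᴴ = A := hA.isSelfAdjoint
    rw [IsSelfAdjoint, Matrix.star_eq_conjTranspose]
    nth_rewrite 2 [← h]
    rfl

theorem IsPVM.transpose {d m : ℕ} {E : Fin m → Matrix (Fin d) (Fin d) ℂ} (hE : IsPVM E) :
    IsPVM fun i => (E i)ᵀ :=
  ⟨fun i => (hE.1 i).matrix_transpose, by rw [← Matrix.transpose_sum, hE.2, Matrix.transpose_one]⟩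

theorem star_vec_dotProduct_kronecker {a b : ℕ} (X : Matrix (Fin b) (Fin a) ℂ)
    (A : Matrix (Fin a) (Fin a) ℂ) (B : Matrix (Fin b) (Fin b) ℂ) :
    star X.vec ⬝ᵥ ((A ⊗ₖ B) *ᵥ X.vec) = (Xᴴ * (B * X * Aᵀ)).trace := by
  rw [Matrix.kronecker_mulVec_vec, Matrix.star_vec_dotProduct_vec]

/-- A synchronous quantum correlation is given by a density matrix that commutes with the
measurement projections. -/
theorem exists_tracial_of_mem_syncQuantumCorr {n m : ℕ} {p : CorrTensor n m}
    (hp : p ∈ syncQuantumCorr n m) :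
    ∃ (d : ℕ) (E : Fin n → Fin m → Matrix (Fin d) (Fin d) ℂ) (ρ : Matrix (Fin d) (Fin d) ℂ),
      (∀ x, IsPVM (E x)) ∧ ρ.PosSemidef ∧ ρ.trace = 1 ∧ (∀ x i, Commute (E x i) ρ) ∧
      ∀ i j x y, (p i j x y : ℂ) = (ρ * (E x i * E y j)).trace := by
  obtain ⟨⟨a, b, E, F, φ, hE, hF, hφ, hp⟩, hs⟩ := hp
  obtain ⟨X, rfl⟩ := Matrix.vec_bijective.2 φ
  simp only [star_vec_dotProduct_kronecker] at hp
  rw [Matrix.star_vec_dotProduct_vec] at hφ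
  have hEs : ∀ x i, (E x i)ᵀᴴ = (E x i)ᵀ := fun x i =>
    ((hE x).1 i).matrix_transpose.isSelfAdjoint
  have hEi : ∀ x i, (E x i)ᵀ * (E x i)ᵀ = (E x i)ᵀ := fun x i =>
    ((hE x).1 i).matrix_transpose.isIdempotentElem
  have hFs : ∀ x i, (F x i)ᴴ = F x i := fun x i => ((hF x).1 i).isSelfAdjoint
  have hFi : ∀ x i, F x i * F x i = F x i := fun x i => ((hF x).1 i).isIdempotentElem
  -- The squared Hilbert-Schmidt norm of this matrix is `p i j x x`.
  have hzero : ∀ x i j, i ≠ j → F x j * X * (E x i)ᵀ = 0 := fun x i j hij => by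
    rw [← Matrix.trace_conjTranspose_mul_self_eq_zero_iff]
    have h := hp i j x x
    rw [hs x i j hij] at h
    rw [Matrix.conjTranspose_mul, Matrix.conjTranspose_mul, hEs, hFs, Matrix.mul_assoc,
      Matrix.trace_mul_comm]
    calc _ = (Xᴴ * ((F x j * F x j) * X * ((E x i)ᵀ * (E x i)ᵀ))).trace := by
          simp only [Matrix.mul_assoc]
      _ = 0 := by rw [hEi, hFi, ← h]; simp
  have hintertwine : ∀ x i, F x i * X = X * (E x i)ᵀ := fun x i => by
    have hE1 : ∑ j, (E x j)ᵀ = 1 := (hE x).transpose.2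
    calc F x i * X = F x i * X * ∑ j, (E x j)ᵀ := by rw [hE1, Matrix.mul_one]
      _ = F x i * X * (E x i)ᵀ := by
          rw [Matrix.mul_sum]
          exact Finset.sum_eq_single i (fun j _ hj => hzero x j i hj) (by simp)
      _ = (∑ j, F x j) * X * (E x i)ᵀ := by
          rw [Matrix.sum_mul, Matrix.sum_mul]
          exact (Finset.sum_eq_single i (fun j _ hj => hzero x i j hj.symm) (by simp)).symm
      _ = X * (E x i)ᵀ := by rw [(hF x).2, Matrix.one_mul]
  have hcomm : ∀ x i, Commute (E x i)ᵀ (Xᴴ * X) := fun x i => by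
    have h : Xᴴ * F x i = (E x i)ᵀ * Xᴴ := by
      have := congrArg Matrix.conjTranspose (hintertwine x i)
      rwa [Matrix.conjTranspose_mul, Matrix.conjTranspose_mul, hEs, hFs] at this
    rw [Commute, SemiconjBy, ← Matrix.mul_assoc, ← h, Matrix.mul_assoc, hintertwine,
      Matrix.mul_assoc]
  refine ⟨a, fun x i => (E x i)ᵀ, Xᴴ * X, fun x => (hE x).transpose,
    Matrix.posSemidef_conjTranspose_mul_self X, hφ, hcomm, fun i j x y => ?_⟩
  calc (p i j x y : ℂ) = ((Xᴴ * X * (E y j)ᵀ) * (E x i)ᵀ).trace := by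
        rw [hp, hintertwine]; simp only [Matrix.mul_assoc]
    _ = _ := by rw [Matrix.trace_mul_comm, ← mul_assoc, (hcomm x i).eq, mul_assoc]

/-- The vectorized square root of `ρ` is a purification, and it commutes with the projections. -/
theorem mem_quantumCorr_of_tracial {n m d : ℕ} {p : CorrTensor n m}
    {E : Fin n → Fin m → Matrix (Fin d) (Fin d) ℂ} {ρ : Matrix (Fin d) (Fin d) ℂ}
    (hE : ∀ x, IsPVM (E x)) (hρ : ρ.PosSemidef) (hρ1 : ρ.trace = 1)
    (hc : ∀ x i, Commute (E x i) ρ)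
    (hp : ∀ i j x y, (p i j x y : ℂ) = (ρ * (E x i * E y j)).trace) : p ∈ quantumCorr n m := by
  obtain ⟨S, hS, hSρ, hSc⟩ := exists_sqrt_commute hρ
  refine ⟨d, d, fun x i => (E x i)ᵀ, E, S.vec, fun x => (hE x).transpose, hE, ?_,
    fun i j x y => ?_⟩
  · rw [Matrix.star_vec_dotProduct_vec, hS, hSρ, hρ1]
  · rw [star_vec_dotProduct_kronecker, hp, hS, Matrix.transpose_transpose]
    symm
    calc (S * (E y j * S * E x i)).trace = ((S * S * E y j) * E x i).trace := by
          rw [(hSc _ (hc y j)).eq]; simp only [mul_assoc]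
      _ = _ := by rw [hSρ, Matrix.trace_mul_comm, ← mul_assoc, (hc x i).eq, mul_assoc]

end TracialForm

/-! ### Qubit projections and the elliptope -/

section Bloch

open scoped ComplexOrder

/-- The rows of the square root of `A` are unit vectors in `ℝ³` with Gram matrix `A`; they serve as
Bloch vectors. -/
theorem exists_projections_of_mem_elliptope {A : Matrix (Fin 3) (Fin 3) ℝ}
    (hA : A ∈ elliptope 3) :
    ∃ P : Fin 3 → Matrix (Fin 2) (Fin 2) ℂ, (∀ x, IsStarProjection (P x)) ∧
      (∀ x, (P x).trace = 1) ∧ ∀ x y, (P x * P y).trace = ((1 + A x y) / 2 : ℝ) := by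
  obtain ⟨hp, h1⟩ := hA
  obtain ⟨S, hS, hSA, -⟩ := exists_sqrt_commute hp
  have hSs : ∀ x y, S x y = S y x := fun x y => by
    have := congrFun₂ hS y x
    simpa using this
  have hg : ∀ x y, S x 0 * S y 0 + S x 1 * S y 1 + S x 2 * S y 2 = A x y := fun x y => by
    rw [← hSA, Matrix.mul_apply, Fin.sum_univ_three, hSs 0 y, hSs 1 y, hSs 2 y]
  refine ⟨fun x => !![((1 + S x 2) / 2 : ℂ), (S x 0 - Complex.I * S x 1) / 2;
    (S x 0 + Complex.I * S x 1) / 2, (1 - S x 2) / 2], fun x => ⟨?_, ?_⟩, fun x => ?_,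
    fun x y => ?_⟩
  · have h := (hg x x).trans (h1 x)
    have hc : (S x 0 * S x 0 + S x 1 * S x 1 + S x 2 * S x 2 : ℂ) = 1 := by exact_mod_cast h
    have hI := Complex.I_mul_I
    ext i j
    fin_cases i <;> fin_cases j <;> simp [Matrix.mul_apply, Fin.sum_univ_two]
    · linear_combination (1 / 4 : ℂ) * hc - (1 / 4 : ℂ) * (S x 1) ^ 2 * hI
    · ring
    · ring
    · linear_combination (1 / 4 : ℂ) * hc - (1 / 4 : ℂ) * (S x 1) ^ 2 * hI
  · ext i j
    fin_cases i <;> fin_cases j <;> simp [sub_eq_add_neg]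
  · simp [Matrix.trace_fin_two]
    ring
  · have hc : (S x 0 * S y 0 + S x 1 * S y 1 + S x 2 * S y 2 : ℂ) = A x y := by
      exact_mod_cast hg x y
    have hI := Complex.I_mul_I
    simp [Matrix.trace_fin_two]
    linear_combination (1 / 2 : ℂ) * hc - (1 / 2 : ℂ) * (S x 1) * (S y 1) * hI

theorem trace_projection_mul_eq_ofReal {d : Type*} [Fintype d] {P Q : Matrix d d ℂ}
    (hP : IsStarProjection P) (hQ : IsStarProjection Q) :
    (P * Q).trace = ((P * Q).trace.re : ℂ) := by
  have h : star (P * Q).trace = (P * Q).trace := by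
    have hPs : Pᴴ = P := hP.isSelfAdjoint
    have hQs : Qᴴ = Q := hQ.isSelfAdjoint
    rw [← Matrix.trace_conjTranspose, Matrix.conjTranspose_mul, hPs, hQs, Matrix.trace_mul_comm]
  exact (Complex.conj_eq_iff_re.1 h).symm

theorem S21_eq_image_elliptope :
    S21 = {w | ∃ A ∈ elliptope 3,
      w = (1 / 4 : ℝ) • (upperEntries (fun x y => A x y) + ![1, 1, 1])} := by
  ext w
  constructor
  · rintro ⟨P, q, hP, hP1, hq, rfl⟩
    have htr : ∀ x, (P x).trace = 1 := fun x => by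
      have := hP1 x
      simp only [normTrace] at this
      push_cast at this
      linear_combination 2 * this
    have hPs : ∀ x, (P x)ᴴ = P x := fun x => (hP x).isSelfAdjoint
    have hPi : ∀ x, P x * P x = P x := fun x => (hP x).isIdempotentElem
    have hq' : ∀ x y, q x y = traceRe 1 (P x * P y) / 2 := fun x y => by
      have := congrArg Complex.re (hq x y)
      simp only [Complex.ofReal_re] at this
      rw [this, normTrace, trace_projection_mul_eq_ofReal (hP x) (hP y), traceRe_apply, one_mul]
      have h2 : ((2 : ℕ) : ℂ)⁻¹ = ((1 / 2 : ℝ) : ℂ) := by push_cast; norm_num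
      rw [h2, ← Complex.ofReal_mul, Complex.ofReal_re]
      ring
    have htr' : ∀ x, traceRe 1 (P x) = 1 := fun x => by simp [traceRe_apply, htr]
    -- The elliptope matrix is the Gram matrix of the symmetries `2 P_x - 1` for the normalized
    -- trace.
    have hG := gram_posSemidef (ρ := (2⁻¹ : ℝ) • (1 : Matrix (Fin 2) (Fin 2) ℂ)) (Q := 1)
      (Matrix.PosSemidef.one.smul (by norm_num))
      (.one _) (Commute.one_left _) (U := fun x => 2 • P x - 1)
      fun x => by simp [two_smul, hPs]
    have hval : ∀ x y, traceRe ((2⁻¹ : ℝ) • (1 : Matrix (Fin 2) (Fin 2) ℂ))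
        (1 * ((2 • P x - 1) * (2 • P y - 1))) = 4 * q x y - 1 := fun x y => by
      have h1 : (2 • P x - 1) * (2 • P y - 1) =
          4 • (P x * P y) - 2 • P x - 2 • P y + 1 := by noncomm_ring
      have h2 : ∀ Z, traceRe ((2⁻¹ : ℝ) • (1 : Matrix (Fin 2) (Fin 2) ℂ)) Z =
          2⁻¹ * traceRe 1 Z := fun Z => by
        simp [traceRe_apply, Matrix.trace_smul]
      have h3 : traceRe 1 (1 : Matrix (Fin 2) (Fin 2) ℂ) = 2 := by simp [traceRe_apply]
      rw [one_mul, h1, h2, map_add, map_sub, map_sub, map_nsmul, map_nsmul, map_nsmul, htr', htr',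
        h3, hq']
      simp only [nsmul_eq_mul]
      push_cast
      ring
    refine ⟨_, ⟨hG, fun x => ?_⟩, ?_⟩
    · rw [Matrix.of_apply, hval, hq', hPi, htr']
      norm_num
    · simp only [Matrix.of_apply, hval]
      ext k
      fin_cases k <;> simp [upperEntries]
  · rintro ⟨A, hA, rfl⟩
    obtain ⟨P, hP, hP1, hPP⟩ := exists_projections_of_mem_elliptope hA
    refine ⟨P, fun x y => (1 + A x y) / 4, hP, fun x => ?_, fun x y => ?_, ?_⟩
    · simp [normTrace, hP1]
    · rw [normTrace, hPP]
      push_cast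
      ring
    · ext k
      fin_cases k <;> simp [upperEntries] <;> ring

theorem exists_elliptope_smul {G : Matrix (Fin 3) (Fin 3) ℝ} (hG : G.PosSemidef) {m : ℝ}
    (hm : ∀ x, G x x = m) : ∃ A ∈ elliptope 3, G = m • A := by
  have hm0 : 0 ≤ m := by rw [← hm 0]; exact hG.diag_nonneg (i := 0)
  rcases hm0.eq_or_lt with h | h
  · refine ⟨1, ⟨.one, fun i => by simp⟩, ?_⟩
    ext x y
    have := abs_apply_le_of_posSemidef hG hm x y
    rw [← h] at this
    simpa [← h] using this
  · refine ⟨m⁻¹ • G, ⟨hG.smul (by positivity), fun i => ?_⟩, ?_⟩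
    · simp [hm, h.ne']
    · rw [smul_smul, mul_inv_cancel₀ h.ne', one_smul]

end Bloch

/-! ### The synchronous correlations as an image of the model -/

section Tensor

open scoped ComplexOrder

/-- The two-outcome tensor with given correlations `q` of the first outcomes. -/
def corrOf (q : Fin 3 → Fin 3 → ℝ) : CorrTensor 3 2 := fun i j x y =>
  ![![q x y, q x x - q x y], ![q y y - q x y, 1 - q x x - q y y + q x y]] i j

theorem trace_tracial_eq_ofReal {d : Type*} [Fintype d] {ρ P Q : Matrix d d ℂ} (hρ : ρᴴ = ρ)
    (hP : Pᴴ = P) (hQ : Qᴴ = Q) (hPρ : Commute P ρ) :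
    (ρ * (P * Q)).trace = ((ρ * (P * Q)).trace.re : ℂ) := by
  have h : star (ρ * (P * Q)).trace = (ρ * (P * Q)).trace := by
    rw [← Matrix.trace_conjTranspose, Matrix.conjTranspose_mul, Matrix.conjTranspose_mul, hP, hQ,
      hρ, mul_assoc, hPρ.eq, Matrix.trace_mul_comm, mul_assoc]
  exact (Complex.conj_eq_iff_re.1 h).symm

theorem exists_mem_tracialModel {p : CorrTensor 3 2} (hp : p ∈ syncQuantumCorr 3 2) :
    ∃ q ∈ tracialModel, p = corrOf q := by
  obtain ⟨d, E, ρ, hE, hρ, hρ1, hc, hp⟩ := exists_tracial_of_mem_syncQuantumCorr hp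
  have hE0 : ∀ x, IsStarProjection (E x 0) := fun x => (hE x).1 0
  have hE1 : ∀ x, E x 1 = 1 - E x 0 := fun x => by
    rw [← (hE x).2, Fin.sum_univ_two, add_sub_cancel_left]
  have hEi : ∀ x, E x 0 * E x 0 = E x 0 := fun x => (hE0 x).isIdempotentElem
  refine ⟨fun x y => traceRe ρ (E x 0 * E y 0),
    mem_tracialModel_of_posSemidef hρ hρ1 hE0 fun x => hc x 0, ?_⟩
  have hp' : ∀ i j x y, p i j x y = traceRe ρ (E x i * E y j) := fun i j x y => by
    rw [traceRe_apply, ← hp, Complex.ofReal_re]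
  have h1 : traceRe ρ 1 = 1 := by simp [traceRe_apply, hρ1]
  ext i j x y
  fin_cases i <;> fin_cases j <;>
    simp [hp', corrOf, hEi, hE1, mul_sub, sub_mul, h1]
  ring

theorem corrOf_mem_syncQuantumCorr {d : Type*} [Fintype d] [DecidableEq d] {ρ : Matrix d d ℂ}
    (hρ : ρ.PosSemidef) (hρ1 : ρ.trace = 1) {P : Fin 3 → Matrix d d ℂ}
    (hP : ∀ x, IsStarProjection (P x)) (hPρ : ∀ x, Commute (P x) ρ) :
    corrOf (fun x y => traceRe ρ (P x * P y)) ∈ syncQuantumCorr 3 2 := by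
  have hPs : ∀ x, (P x)ᴴ = P x := fun x => (hP x).isSelfAdjoint
  have hPi : ∀ x, P x * P x = P x := fun x => (hP x).isIdempotentElem
  set e := Fintype.equivFin d
  set f := Matrix.reindexAlgEquiv ℂ ℂ e with hf
  have hfs : ∀ A, (f A)ᴴ = f Aᴴ := fun A => rfl
  have hft : ∀ A, (f A).trace = A.trace := fun A => by
    simp [hf, Matrix.trace, Matrix.coe_reindexAlgEquiv, Equiv.sum_comp e.symm fun i => A i i]
  have hfp : ∀ A, IsStarProjection A → IsStarProjection (f A) := fun A hA => by
    refine ⟨?_, ?_⟩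
    · rw [IsIdempotentElem, ← map_mul, hA.isIdempotentElem.eq]
    · have hAs : Aᴴ = A := hA.isSelfAdjoint
      rw [IsSelfAdjoint, Matrix.star_eq_conjTranspose, hfs, hAs]
  refine ⟨mem_quantumCorr_of_tracial (E := fun x => ![f (P x), f (1 - P x)]) (ρ := f ρ)
    (fun x => ⟨fun i => ?_, ?_⟩) (hρ.submatrix _) (by rw [hft, hρ1]) (fun x i => ?_) ?_, ?_⟩
  · fin_cases i
    exacts [hfp _ (hP x), hfp _ (hP x).one_sub]
  · simp [Fin.sum_univ_two]
  · fin_cases i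
    · exact (hPρ x).map f
    · exact ((Commute.one_left _).sub_left (hPρ x)).map f
  · have hpp : ∀ x y, (ρ * (P x * P y)).trace = (traceRe ρ (P x * P y) : ℂ) := fun x y =>
      trace_tracial_eq_ofReal hρ.isHermitian (hPs x) (hPs y) (hPρ x)
    have hp : ∀ x, (ρ * P x).trace = (traceRe ρ (P x) : ℂ) := fun x => by
      rw [← hPi x, hpp]
    intro i j x y
    fin_cases i <;> fin_cases j <;>
      simp [corrOf, ← map_mul, hft, -map_sub, mul_sub, sub_mul, hpp, hp, hρ1, hPi]
    ring
  · intro x i j hij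
    fin_cases i <;> fin_cases j <;> simp [corrOf] at hij ⊢

/-- Realized on a direct sum of eight one-dimensional blocks, with weights `lam`, and one qubit in
the state `m / 2 • 1`. -/
theorem corrOf_mem_of_mem_tracialModel {q : Fin 3 → Fin 3 → ℝ} (hq : q ∈ tracialModel) :
    corrOf q ∈ syncQuantumCorr 3 2 := by
  obtain ⟨lam, m, G, hl, hG, hm, hs, hq⟩ := hq
  have hm0 : 0 ≤ m := by rw [← hm 0]; exact hG.diag_nonneg (i := 0)
  obtain ⟨A, hA, hGA⟩ := exists_elliptope_smul hG hm
  obtain ⟨Q, hQ, -, hQQ⟩ := exists_projections_of_mem_elliptope hA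
  have hQs : ∀ x, (Q x)ᴴ = Q x := fun x => (hQ x).isSelfAdjoint
  have hQi : ∀ x, Q x * Q x = Q x := fun x => (hQ x).isIdempotentElem
  set P : Fin 3 → Matrix ((Fin 3 → Bool) ⊕ Fin 2) ((Fin 3 → Bool) ⊕ Fin 2) ℂ := fun x =>
    Matrix.fromBlocks (Matrix.diagonal fun e => (bitVal (e x) : ℂ)) 0 0 (Q x) with hP
  set ρ : Matrix ((Fin 3 → Bool) ⊕ Fin 2) ((Fin 3 → Bool) ⊕ Fin 2) ℂ :=
    Matrix.fromBlocks (Matrix.diagonal fun e => (lam e : ℂ)) 0 0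
      (Matrix.diagonal fun _ => ((m / 2 : ℝ) : ℂ)) with hρ
  have htb : ∀ (A : Matrix (Fin 3 → Bool) (Fin 3 → Bool) ℂ) (D : Matrix (Fin 2) (Fin 2) ℂ),
      (Matrix.fromBlocks A 0 0 D).trace = A.trace + D.trace := fun A D => by
    simp [Matrix.trace]
  have hbit : ∀ b, bitVal b * bitVal b = bitVal b := fun b => by cases b <;> simp [bitVal]
  have hρp : ρ.PosSemidef := by
    rw [hρ, Matrix.fromBlocks_diagonal]
    refine Matrix.PosSemidef.diagonal fun i => ?_
    cases i with
    | inl e => simpa using hl e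
    | inr i => exact Complex.zero_le_real.2 (by positivity)
  have hPp : ∀ x, IsStarProjection (P x) := fun x => by
    refine ⟨?_, ?_⟩
    · simp only [IsIdempotentElem, hP, Matrix.fromBlocks_multiply, Matrix.diagonal_mul_diagonal,
        hQi, ← Complex.ofReal_mul, hbit, Matrix.mul_zero, Matrix.zero_mul,
        add_zero, zero_add]
    · rw [IsSelfAdjoint, Matrix.star_eq_conjTranspose]
      simp [hP, Matrix.fromBlocks_conjTranspose, hQs, Matrix.diagonal_conjTranspose, Pi.star_def]
  have hsc : (Matrix.diagonal fun _ => ((m / 2 : ℝ) : ℂ)) =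
      ((m / 2 : ℝ) : ℂ) • (1 : Matrix (Fin 2) (Fin 2) ℂ) := by
    rw [Matrix.smul_one_eq_diagonal]
  have hPρ : ∀ x, Commute (P x) ρ := fun x => by
    simp [Commute, SemiconjBy, hP, hρ, hsc, Matrix.fromBlocks_multiply, mul_comm,
      -Complex.ofReal_div]
  convert corrOf_mem_syncQuantumCorr hρp ?_ hPp hPρ using 2
  · ext x y
    rw [hq, traceRe_apply, hGA]
    simp only [hρ, hP, Matrix.fromBlocks_multiply, Matrix.diagonal_mul_diagonal, hsc, Matrix.mul_zero,
      Matrix.zero_mul, add_zero, zero_add, htb, Matrix.trace_diagonal, smul_mul_assoc,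
      one_mul, Matrix.trace_smul, hQQ, ← Complex.ofReal_mul, ← Complex.ofReal_sum, smul_eq_mul,
      ← Complex.ofReal_add, Complex.ofReal_re, Matrix.smul_apply]
    ring
  · rw [hρ, htb, Matrix.trace_diagonal, Matrix.trace_diagonal]
    rw [Fin.sum_univ_two, ← Complex.ofReal_sum, ← Complex.ofReal_add, ← Complex.ofReal_add]
    exact_mod_cast (by linarith : ∑ e, lam e + (m / 2 + m / 2) = 1)

theorem syncQuantumCorr_eq_image : syncQuantumCorr 3 2 = corrOf '' tracialModel := by
  ext p
  constructor
  · intro hp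
    obtain ⟨q, hq, rfl⟩ := exists_mem_tracialModel hp
    exact ⟨q, hq, rfl⟩
  · rintro ⟨q, hq, rfl⟩
    exact corrOf_mem_of_mem_tracialModel hq

theorem isClosed_syncQuantumCorr : IsClosed (syncQuantumCorr 3 2) := by
  rw [syncQuantumCorr_eq_image]
  refine (isCompact_tracialModel.image ?_).isClosed
  refine continuous_pi fun i => continuous_pi fun j => continuous_pi fun x => continuous_pi
    fun y => ?_
  fin_cases i <;> fin_cases j <;> simp only [corrOf] <;> simp <;> fun_prop

theorem hatSlice_eq (r : Fin 3 → ℝ) :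
    hatSlice r = {w | ∃ q ∈ tracialModel, (∀ x, q x x = r x) ∧ w = upperEntries q} := by
  have hmarg : ∀ q x, marginal (corrOf q) 0 x = q x x := fun q x => by
    simp [marginal, corrOf, Fin.sum_univ_two]
  have hup : ∀ q, upperEntries (fun x y => corrOf q 0 0 x y) = upperEntries q := fun q => by
    simp [corrOf]
  ext w
  simp only [hatSlice, syncQuantumCorr_eq_image, Set.exists_mem_image, hmarg, hup,
    Set.mem_ofPred_eq]

end Tensor

/-! ### Relabelling projections and outcomes -/

section Symmetries

theorem symm_of_mem_tracialModel {q : Fin 3 → Fin 3 → ℝ} (hq : q ∈ tracialModel) (x y : Fin 3) :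
    q x y = q y x := by
  obtain ⟨lam, m, G, -, hG, -, -, hq⟩ := hq
  have hs : G x y = G y x := by simpa using hG.isHermitian.apply y x
  rw [hq, hq, hs]
  simp only [mul_comm]

theorem tracialModel_comp_perm {q : Fin 3 → Fin 3 → ℝ} (hq : q ∈ tracialModel)
    (σ : Equiv.Perm (Fin 3)) : (fun x y => q (σ x) (σ y)) ∈ tracialModel := by
  obtain ⟨lam, m, G, hl, hG, hm, hs, hq⟩ := hq
  set E : (Fin 3 → Bool) ≃ (Fin 3 → Bool) := σ.arrowCongr (Equiv.refl _)
  have hE : ∀ e x, E e (σ x) = e x := fun e x => by simp [E, Equiv.arrowCongr]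
  refine ⟨fun e => lam (E e), m, G.submatrix σ σ, fun e => hl _, hG.submatrix _,
    fun x => hm _, ?_, fun x y => ?_⟩
  · rw [← hs, Equiv.sum_comp E lam]
  · beta_reduce
    rw [hq, ← Equiv.sum_comp E]
    simp only [hE, Matrix.submatrix_apply]

/-- The effect on `(τ(P_x P_y))` of replacing `P_x` by `1 - P_x` where `s x = -1`. -/
noncomputable def flipEntry (s r : Fin 3 → ℝ) (x y : Fin 3) (w : ℝ) : ℝ :=
  (1 + s x * (2 * r x - 1) + s y * (2 * r y - 1) +
    s x * s y * (4 * w - 2 * r x - 2 * r y + 1)) / 4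

/-- The effect on `τ(P_x)` of replacing `P_x` by `1 - P_x` where `s x = -1`. -/
noncomputable def flipMarginal (s r : Fin 3 → ℝ) (x : Fin 3) : ℝ := (1 + s x * (2 * r x - 1)) / 2

theorem flipEntry_flipEntry {s : Fin 3 → ℝ} (hs : ∀ x, s x * s x = 1) (r : Fin 3 → ℝ)
    (x y : Fin 3) (w : ℝ) :
    flipEntry s (flipMarginal s r) x y (flipEntry s r x y w) = w := by
  simp only [flipEntry, flipMarginal]
  linear_combination ((2 * r x - 1) / 4 + s y * s y * (w - (r x + r y) / 2 + 1 / 4)) * hs x +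
    ((2 * r y - 1) / 4 + (w - (r x + r y) / 2 + 1 / 4)) * hs y

theorem flipMarginal_flipMarginal {s : Fin 3 → ℝ} (hs : ∀ x, s x * s x = 1) (r : Fin 3 → ℝ) :
    flipMarginal s (flipMarginal s r) = r := by
  ext x
  simp only [flipMarginal]
  linear_combination (r x - 1 / 2) * hs x

/-- Complementing projections negates bits of the deterministic triples and conjugates the Gram part
by `diag(s)`. -/
theorem tracialModel_flip {q : Fin 3 → Fin 3 → ℝ} (hq : q ∈ tracialModel) {s : Fin 3 → ℝ}
    (hs : ∀ x, s x = 1 ∨ s x = -1) :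
    (fun x y => flipEntry s (fun x => q x x) x y (q x y)) ∈ tracialModel := by
  obtain ⟨lam, m, G, hl, hG, hm, hsum, hq⟩ := hq
  have hs2 : ∀ x, s x * s x = 1 := fun x => by rcases hs x with h | h <;> simp [h]
  set f : (Fin 3 → Bool) → (Fin 3 → Bool) := fun e x => if s x = 1 then e x else !(e x) with hf
  have hinv : Function.Involutive f := fun e => by
    ext x
    by_cases h : s x = 1 <;> simp [hf, h]
  have hbit : ∀ e x, bitVal (f e x) = (1 + s x * (2 * bitVal (e x) - 1)) / 2 := fun e x => by
    rcases hs x with h | h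
    · simp [hf, h]
    · have h' : (-1 : ℝ) ≠ 1 := by norm_num
      cases hex : e x <;> simp [hf, h, hex, bitVal, h'] <;> norm_num
  have hb : ∀ b, bitVal b * bitVal b = bitVal b := fun b => by cases b <;> simp [bitVal]
  have hG' : (Matrix.diagonal s * G * Matrix.diagonal s).PosSemidef := by
    have := hG.conjTranspose_mul_mul_same (Matrix.diagonal s)
    rwa [Matrix.diagonal_conjTranspose, star_trivial] at this
  refine ⟨fun e => lam (f e), m, _, fun e => hl _, hG', fun x => ?_, ?_, fun x y => ?_⟩
  · rw [Matrix.mul_diagonal, Matrix.diagonal_mul, hm, mul_right_comm, hs2, one_mul]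
  · rw [← hsum, ← Equiv.sum_comp hinv.toPerm lam]
    rfl
  · have hdiag : ∀ x, q x x = ∑ e, lam e * bitVal (e x) + m / 2 := fun x => by
      rw [hq, hm]
      simp only [hb]
      ring
    have e1 : ∑ e, lam (f e) * (bitVal (e x) * bitVal (e y)) =
        ∑ e, lam e * (bitVal (f e x) * bitVal (f e y)) := by
      rw [← Equiv.sum_comp hinv.toPerm (fun e => lam e * (bitVal (f e x) * bitVal (f e y)))]
      refine Finset.sum_congr rfl fun e _ => ?_
      simp [hinv e]
    have e2 : ∑ e, lam e * (bitVal (f e x) * bitVal (f e y)) =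
        (1 - s x) * (1 - s y) / 4 * ∑ e, lam e + (1 - s y) * s x / 2 * ∑ e, lam e * bitVal (e x) +
        (1 - s x) * s y / 2 * ∑ e, lam e * bitVal (e y) +
        s x * s y * ∑ e, lam e * (bitVal (e x) * bitVal (e y)) := by
      simp only [Finset.mul_sum, ← Finset.sum_add_distrib, hbit]
      exact Finset.sum_congr rfl fun e _ => by ring
    simp only [flipEntry]
    rw [e1, e2, Matrix.mul_diagonal, Matrix.diagonal_mul, hdiag, hdiag, hq]
    linear_combination (-(1 - s x) * (1 - s y) / 4) * hsum

/-- The positions `(1,2), (1,3), (2,3)` of the entries above the diagonal. -/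
def upperRow : Fin 3 → Fin 3 := ![0, 0, 1]

/-- The column indices of the entries above the diagonal. -/
def upperCol : Fin 3 → Fin 3 := ![1, 2, 2]

theorem upperEntries_apply (q : Fin 3 → Fin 3 → ℝ) (k : Fin 3) :
    upperEntries q k = q (upperRow k) (upperCol k) := by
  fin_cases k <;> rfl

theorem hatSlice_perm (s : Fin 3 → ℝ) (σ : Equiv.Perm (Fin 3)) :
    ∃ T : (Fin 3 → ℝ) ≃ᵃ[ℝ] (Fin 3 → ℝ), hatSlice s = T '' hatSlice (fun x => s (σ x)) := by
  -- The pair at position `k` is the complement of the index `Fin.rev k`, so `σ` acts on positions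
  -- through its conjugate by `Fin.rev`.
  have key : ∀ (σ : Equiv.Perm (Fin 3)) (q : Fin 3 → Fin 3 → ℝ), (∀ x y, q x y = q y x) →
      ∀ k, upperEntries (fun x y => q (σ x) (σ y)) k =
        upperEntries q (Fin.rev (σ (Fin.rev k))) := fun σ q hq k => by
    have h : (upperRow (Fin.rev (σ (Fin.rev k))) = σ (upperRow k) ∧
        upperCol (Fin.rev (σ (Fin.rev k))) = σ (upperCol k)) ∨
        (upperRow (Fin.rev (σ (Fin.rev k))) = σ (upperCol k) ∧
        upperCol (Fin.rev (σ (Fin.rev k))) = σ (upperRow k)) := by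
      revert σ k
      decide
    rw [upperEntries_apply, upperEntries_apply]
    rcases h with ⟨h1, h2⟩ | ⟨h1, h2⟩
    · rw [h1, h2]
    · rw [h1, h2, hq]
  set π : Equiv.Perm (Fin 3) := (Fin.revPerm.trans σ.symm).trans Fin.revPerm with hπ
  refine ⟨(LinearEquiv.funCongrLeft ℝ ℝ π).toAffineEquiv, ?_⟩
  rw [hatSlice_eq, hatSlice_eq]
  ext w
  constructor
  · rintro ⟨q, hq, hd, rfl⟩
    refine ⟨_, ⟨_, tracialModel_comp_perm hq σ, fun x => hd _, rfl⟩, ?_⟩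
    ext k
    change upperEntries (fun x y => q (σ x) (σ y)) (π k) = _
    rw [key σ q (symm_of_mem_tracialModel hq)]
    simp [hπ]
  · rintro ⟨_, ⟨q, hq, hd, rfl⟩, rfl⟩
    refine ⟨_, tracialModel_comp_perm hq σ.symm, fun x => by simp [hd], ?_⟩
    ext k
    rw [key σ.symm q (symm_of_mem_tracialModel hq)]
    rfl

theorem hatSlice_flip (r : Fin 3 → ℝ) {s : Fin 3 → ℝ} (hs : ∀ x, s x = 1 ∨ s x = -1) :
    ∃ T : (Fin 3 → ℝ) ≃ᵃ[ℝ] (Fin 3 → ℝ), hatSlice r = T '' hatSlice (flipMarginal s r) := by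
  have hs2 : ∀ x, s x * s x = 1 := fun x => by rcases hs x with h | h <;> simp [h]
  set t : Fin 3 → ℝ := fun k => s (upperRow k) * s (upperCol k) with ht
  have ht0 : ∀ k, t k * t k = 1 := fun k => by
    simp only [ht]
    rw [mul_mul_mul_comm, hs2, hs2, one_mul]
  have hfwd : ∀ r w, w ∈ hatSlice r → (fun k => flipEntry s r (upperRow k) (upperCol k) (w k)) ∈
      hatSlice (flipMarginal s r) := fun r w hw => by
    rw [hatSlice_eq] at hw ⊢
    obtain ⟨q, hq, hd, rfl⟩ := hw
    refine ⟨_, tracialModel_flip hq hs, fun x => ?_, ?_⟩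
    · simp only [flipEntry, flipMarginal, hd]
      linear_combination (1 / 4 : ℝ) * hs2 x
    · ext k
      simp only [upperEntries_apply, hd]
  set r' := flipMarginal s r with hr'
  have hr : flipMarginal s r' = r := flipMarginal_flipMarginal hs2 r
  let Λ : (Fin 3 → ℝ) ≃ₗ[ℝ] (Fin 3 → ℝ) := LinearEquiv.ofInvolutive
    { toFun := fun w k => t k * w k
      map_add' := fun v w => by ext k; simp [mul_add]
      map_smul' := fun c w => by ext k; simp; ring }
    (fun w => by ext k; simp [← mul_assoc, ht0])
  set T : (Fin 3 → ℝ) ≃ᵃ[ℝ] (Fin 3 → ℝ) := Λ.toAffineEquiv.trans (AffineEquiv.constVAdd ℝ _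
    (fun k => flipEntry s r' (upperRow k) (upperCol k) 0)) with hT
  have hTa : ∀ w, T w = fun k => flipEntry s r' (upperRow k) (upperCol k) (w k) := fun w => by
    ext k
    have h : T w k = flipEntry s r' (upperRow k) (upperCol k) 0 + t k * w k := rfl
    rw [h]
    simp only [flipEntry, ht]
    ring
  refine ⟨T, ?_⟩
  ext w
  constructor
  · intro hw
    refine ⟨_, hfwd r w hw, ?_⟩
    rw [hTa]
    ext k
    exact flipEntry_flipEntry hs2 r _ _ _
  · rintro ⟨v, hv, rfl⟩
    rw [hTa]
    have := hfwd r' v hv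
    rwa [hr] at this

theorem exists_standard_slice {s : Fin 3 → ℝ} (hs : ∀ x, s x ∈ Set.Icc (0 : ℝ) 1) :
    ∃ σ : Equiv.Perm (Fin 3),
      IsStandardVec (fun x => min (s (σ x)) (1 - s (σ x))) ∧
      ∃ T : (Fin 3 → ℝ) ≃ᵃ[ℝ] (Fin 3 → ℝ),
        hatSlice s = T '' hatSlice (fun x => min (s (σ x)) (1 - s (σ x))) := by
  set f : Fin 3 → ℝ := fun x => min (s x) (1 - s x) with hf
  have hmono : Monotone (f ∘ Tuple.sort f) := Tuple.monotone_sort f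
  refine ⟨Tuple.sort f, ⟨?_, hmono (by decide : (0 : Fin 3) ≤ 1),
    hmono (by decide : (1 : Fin 3) ≤ 2), ?_⟩, ?_⟩
  · exact le_min (hs _).1 (sub_nonneg.2 (hs _).2)
  · change min _ _ ≤ _
    rcases le_total (s (Tuple.sort f 2)) (1 / 2) with h | h
    · exact (min_le_left _ _).trans h
    · exact (min_le_right _ _).trans (by linarith)
  · obtain ⟨T, hT⟩ := hatSlice_perm s (Tuple.sort f)
    set r : Fin 3 → ℝ := fun x => s (Tuple.sort f x) with hr
    obtain ⟨T', hT'⟩ := hatSlice_flip r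
      (s := fun x => if r x ≤ 1 - r x then 1 else -1) fun x => by
        by_cases h : r x ≤ 1 - r x <;> simp [h]
    have hfl : flipMarginal (fun x => if r x ≤ 1 - r x then 1 else -1) r =
        fun x => min (r x) (1 - r x) := by
      ext x
      by_cases h : r x ≤ 1 - r x
      · simp only [flipMarginal, h, if_true, min_eq_left]; ring
      · simp only [flipMarginal, h, if_false, min_eq_right (not_le.1 h).le]; ring
    refine ⟨T'.trans T, ?_⟩
    rw [hT, hT', hfl, AffineEquiv.coe_trans, Set.image_comp]

end Symmetries

/-! ### Decomposition of standard slices -/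

section StandardSlices

theorem mem_smul_S21_iff {m : ℝ} (hm : 0 ≤ m) {v : Fin 3 → ℝ} :
    v ∈ m • S21 ↔ ∃ G : Matrix (Fin 3) (Fin 3) ℝ, G.PosSemidef ∧ (∀ x, G x x = m) ∧
      v = ![(m + G 0 1) / 4, (m + G 0 2) / 4, (m + G 1 2) / 4] := by
  have key : ∀ A : Matrix (Fin 3) (Fin 3) ℝ,
      m • (1 / 4 : ℝ) • (upperEntries (fun x y => A x y) + ![1, 1, 1]) =
      ![(m + (m • A) 0 1) / 4, (m + (m • A) 0 2) / 4, (m + (m • A) 1 2) / 4] := fun A => by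
    ext k
    fin_cases k <;> simp [upperEntries] <;> ring
  rw [S21_eq_image_elliptope, Set.mem_smul_set]
  constructor
  · rintro ⟨_, ⟨A, hA, rfl⟩, rfl⟩
    exact ⟨m • A, hA.1.smul hm, fun x => by simp [hA.2 x], key A⟩
  · rintro ⟨G, hG, hd, rfl⟩
    obtain ⟨A, hA, rfl⟩ := exists_elliptope_smul hG hd
    exact ⟨_, ⟨A, hA, rfl⟩, key A⟩

/-- Membership in a slice, in terms of the weights of the deterministic triples. -/
theorem mem_hatSlice_iff {r w : Fin 3 → ℝ} :
    w ∈ hatSlice r ↔ ∃ (a111 a110 a101 a100 a011 a010 a001 a000 m : ℝ)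
      (G : Matrix (Fin 3) (Fin 3) ℝ), 0 ≤ a111 ∧ 0 ≤ a110 ∧ 0 ≤ a101 ∧ 0 ≤ a100 ∧ 0 ≤ a011 ∧
      0 ≤ a010 ∧ 0 ≤ a001 ∧ 0 ≤ a000 ∧ G.PosSemidef ∧ (∀ x, G x x = m) ∧
      a111 + a110 + a101 + a100 + a011 + a010 + a001 + a000 + m = 1 ∧
      r 0 = a111 + a110 + a101 + a100 + m / 2 ∧ r 1 = a111 + a110 + a011 + a010 + m / 2 ∧
      r 2 = a111 + a101 + a011 + a001 + m / 2 ∧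
      w = ![a111 + a110 + (m + G 0 1) / 4, a111 + a101 + (m + G 0 2) / 4,
        a111 + a011 + (m + G 1 2) / 4] := by
  rw [hatSlice_eq]
  constructor
  · rintro ⟨q, ⟨lam, m, G, hl, hG, hm, hs, hq⟩, hd, rfl⟩
    refine ⟨_, _, _, _, _, _, _, _, m, G, hl ![true, true, true], hl ![true, true, false],
      hl ![true, false, true], hl ![true, false, false], hl ![false, true, true],
      hl ![false, true, false], hl ![false, false, true], hl ![false, false, false], hG, hm, ?_,
      ?_, ?_, ?_, ?_⟩
    · rw [← hs, sum_fin_three_bool]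
    · rw [← hd, hq, sum_fin_three_bool, hm]
      simp [bitVal]
      ring
    · rw [← hd, hq, sum_fin_three_bool, hm]
      simp [bitVal]
      ring
    · rw [← hd, hq, sum_fin_three_bool, hm]
      simp [bitVal]
      ring
    · simp [upperEntries, hq, sum_fin_three_bool, bitVal]
  · rintro ⟨a111, a110, a101, a100, a011, a010, a001, a000, m, G, h1, h2, h3, h4, h5, h6, h7, h8,
      hG, hm, hs, hr0, hr1, hr2, rfl⟩
    set lam : (Fin 3 → Bool) → ℝ := fun e =>
      bif e 0 then (bif e 1 then (bif e 2 then a111 else a110) else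
        (bif e 2 then a101 else a100)) else
        (bif e 1 then (bif e 2 then a011 else a010) else (bif e 2 then a001 else a000)) with hlam
    refine ⟨fun x y => ∑ e, lam e * (bitVal (e x) * bitVal (e y)) + (m + G x y) / 4,
      ⟨lam, m, G, fun e => ?_, hG, hm, ?_, fun x y => rfl⟩, fun x => ?_, ?_⟩
    · simp only [hlam]
      cases e 0 <;> cases e 1 <;> cases e 2 <;> simpa
    · rw [sum_fin_three_bool, ← hs]
      simp [hlam]
    · beta_reduce
      rw [sum_fin_three_bool, hm]
      fin_cases x <;> simp [hlam, bitVal, hr0, hr1, hr2] <;> ring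
    · simp [upperEntries, sum_fin_three_bool, bitVal, hlam]

theorem convex_hatSlice (r : Fin 3 → ℝ) : Convex ℝ (hatSlice r) := by
  rw [hatSlice_eq]
  rintro _ ⟨p, hp, hpr, rfl⟩ _ ⟨q, hq, hqr, rfl⟩ a b ha hb hab
  refine ⟨a • p + b • q, convex_tracialModel hp hq ha hb hab, fun x => ?_, ?_⟩
  · simp only [Pi.add_apply, Pi.smul_apply, hpr, hqr, smul_eq_mul, ← add_mul, hab, one_mul]
  · ext k
    fin_cases k <;> simp [upperEntries]

theorem convexHull_subset_hatSlice {r : Fin 3 → ℝ} (hr : IsStandardVec r) :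
    convexHull ℝ (D1 r ∪ D2 r ∪ D3 r) ⊆ hatSlice r := by
  obtain ⟨h0, h01, h12, h2⟩ := hr
  refine convexHull_min (Set.union_subset (Set.union_subset ?_ ?_) ?_) (convex_hatSlice r)
  · intro w hw
    rw [D1, mem_smul_S21_iff (by positivity)] at hw
    obtain ⟨G, hG, hm, rfl⟩ := hw
    have hM : max 0 (r 0 + r 1 + r 2 - 1) ≤ r 0 := max_le h0 (by linarith)
    have hM' := le_max_right 0 (r 0 + r 1 + r 2 - 1)
    set M := max 0 (r 0 + r 1 + r 2 - 1)
    -- Only triples with at most one `1` are used: they adjust the marginals without contributing to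
    -- `w`.
    refine mem_hatSlice_iff.2 ⟨0, 0, 0, r 0 - M, 0, r 1 - M, r 2 - M, 1 - r 0 - r 1 - r 2 + M,
      2 * M, G, ?_⟩
    refine ⟨le_rfl, le_rfl, le_rfl, ?_, le_rfl, ?_, ?_, ?_, hG, hm, ?_, ?_, ?_, ?_, ?_⟩ <;>
      first | linarith | simp
  · intro w hw
    rw [D2, Set.mem_add] at hw
    obtain ⟨v, hv, _, ⟨t, ⟨ht0, ht1⟩, rfl⟩, rfl⟩ := hw
    rw [mem_smul_S21_iff (by positivity)] at hv
    obtain ⟨G, hG, hm, rfl⟩ := hv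
    -- The qubit part exhausts the first marginal, and `011` with weight `t` gives the shift in the
    -- last coordinate.
    refine mem_hatSlice_iff.2 ⟨0, 0, 0, 0, t, r 1 - r 0 - t, r 2 - r 0 - t, 1 - r 1 - r 2 + t,
      2 * r 0, G, ?_⟩
    refine ⟨le_rfl, le_rfl, le_rfl, le_rfl, ht0, ?_, ?_, ?_, hG, hm, ?_, ?_, ?_, ?_, ?_⟩ <;>
      first | linarith | skip
    simp [add_comm]
  · intro w hw
    rw [D3, Set.mem_add] at hw
    obtain ⟨v, hv, _, rfl, rfl⟩ := hw
    rw [mem_smul_S21_iff (by positivity)] at hv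
    obtain ⟨G, hG, hm, rfl⟩ := hv
    have e1 : min (r 0) (r 2 - r 1) = r 0 - max 0 (r 0 + r 1 - r 2) := by
      rcases le_total 0 (r 0 + r 1 - r 2) with h | h
      · rw [max_eq_right h, min_eq_right (by linarith)]; ring
      · rw [max_eq_left h, min_eq_left (by linarith)]; ring
    have e2 : min (r 1) (r 2 - r 0) = r 1 - max 0 (r 0 + r 1 - r 2) := by
      rcases le_total 0 (r 0 + r 1 - r 2) with h | h
      · rw [max_eq_right h, min_eq_right (by linarith)]; ring
      · rw [max_eq_left h, min_eq_left (by linarith)]; ring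
    rw [e1, e2]
    have hM : max 0 (r 0 + r 1 - r 2) ≤ r 0 := max_le h0 (by linarith)
    have hM' := le_max_right 0 (r 0 + r 1 - r 2)
    have hM0 := le_max_left 0 (r 0 + r 1 - r 2)
    set M := max 0 (r 0 + r 1 - r 2)
    refine mem_hatSlice_iff.2 ⟨0, 0, r 0 - M, 0, r 1 - M, 0, r 2 - r 0 - r 1 + M, 1 - M - r 2,
      2 * M, G, ?_⟩
    refine ⟨le_rfl, le_rfl, ?_, le_rfl, ?_, le_rfl, ?_, ?_, hG, hm, ?_, ?_, ?_, ?_, ?_⟩ <;>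
      first | linarith | skip
    simp [add_comm]

/-- Complementary pairs of deterministic triples (with weights `a, b, c, d` per element) and
multiples of the completely mixed triple can be absorbed into the traceless part. -/
theorem exists_absorb {G : Matrix (Fin 3) (Fin 3) ℝ} (hG : G.PosSemidef) {m : ℝ}
    (hm : ∀ x, G x x = m) {a b c d k : ℝ} (ha : 0 ≤ a) (hb : 0 ≤ b) (hc : 0 ≤ c) (hd : 0 ≤ d)
    (hk : 0 ≤ k) :
    ∃ H : Matrix (Fin 3) (Fin 3) ℝ, H.PosSemidef ∧
      (∀ x, H x x = m + 2 * a + 2 * b + 2 * c + 2 * d + 4 * k) ∧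
      H 0 1 = G 0 1 + 2 * a - 2 * b - 2 * c + 2 * d ∧
      H 0 2 = G 0 2 + 2 * a - 2 * b + 2 * c - 2 * d ∧
      H 1 2 = G 1 2 + 2 * a + 2 * b - 2 * c - 2 * d := by
  have hv := fun v : Fin 3 → ℝ => Matrix.posSemidef_vecMulVec_self_star v
  -- A triple and its complement have opposite sign vectors `±v`, so weight `a` on each adds `2 a v
  -- vᵀ`. The multiple of `1` adds `k` to every entry of `w`.
  refine ⟨G + (2 * a) • Matrix.vecMulVec ![1, 1, 1] (star ![1, 1, 1]) +
    (2 * b) • Matrix.vecMulVec ![-1, 1, 1] (star ![-1, 1, 1]) +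
    (2 * c) • Matrix.vecMulVec ![1, -1, 1] (star ![1, -1, 1]) +
    (2 * d) • Matrix.vecMulVec ![1, 1, -1] (star ![1, 1, -1]) + (4 * k) • 1,
    ((((hG.add ((hv _).smul (by positivity))).add ((hv _).smul (by positivity))).add
      ((hv _).smul (by positivity))).add ((hv _).smul (by positivity))).add
      (Matrix.PosSemidef.one.smul (by positivity)), fun x => ?_, ?_, ?_, ?_⟩
  · have := hm x
    fin_cases x <;> simp at this ⊢ <;> linarith
  all_goals
    simp
    try ring

theorem exists_convex_weight {x y z : ℝ} (hxy : x ≤ y) (hyz : y ≤ z) :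
    ∃ t, 0 ≤ t ∧ t ≤ 1 ∧ y = (1 - t) * x + t * z := by
  rcases (hxy.trans hyz).eq_or_lt with h | h
  · exact ⟨0, le_rfl, zero_le_one, by linarith⟩
  · have h' : 0 < z - x := sub_pos.2 h
    refine ⟨(y - x) / (z - x), div_nonneg (sub_nonneg.2 hxy) h'.le,
      (div_le_one h').2 (by linarith), ?_⟩
    field_simp
    ring

theorem hatSlice_subset_convexHull {r : Fin 3 → ℝ} (hr : IsStandardVec r) :
    hatSlice r ⊆ convexHull ℝ (D1 r ∪ D2 r ∪ D3 r) := by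
  obtain ⟨h0, h01, h12, h2⟩ := hr
  have hD1 : ∀ v ∈ D1 r, v ∈ convexHull ℝ (D1 r ∪ D2 r ∪ D3 r) := fun v hv =>
    subset_convexHull ℝ _ (Or.inl (Or.inl hv))
  have hD2 : ∀ v ∈ D2 r, v ∈ convexHull ℝ (D1 r ∪ D2 r ∪ D3 r) := fun v hv =>
    subset_convexHull ℝ _ (Or.inl (Or.inr hv))
  have hD3 : ∀ v ∈ D3 r, v ∈ convexHull ℝ (D1 r ∪ D2 r ∪ D3 r) := fun v hv =>
    subset_convexHull ℝ _ (Or.inr hv)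
  have hconv := convex_convexHull ℝ (D1 r ∪ D2 r ∪ D3 r)
  intro w hw
  obtain ⟨a111, a110, a101, a100, a011, a010, a001, a000, m, G, h111, h110, h101, h100, h011, h010,
    h001, h000, hG, hm, hs, hr0, hr1, hr2, rfl⟩ := mem_hatSlice_iff.1 hw
  have hm0 : 0 ≤ m := by rw [← hm 0]; exact hG.diag_nonneg (i := 0)
  rcases le_total a000 a111 with c0 | c0
  · obtain ⟨H, hH, hHm, e01, e02, e12⟩ := exists_absorb hG hm h000 h011 h101 h110
      (sub_nonneg.2 c0)
    have hM : 2 * (r 0 + r 1 + r 2 - 1) =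
        m + 2 * a000 + 2 * a011 + 2 * a101 + 2 * a110 + 4 * (a111 - a000) := by linarith
    refine hD1 _ ?_
    rw [D1, max_eq_right (by linarith), mem_smul_S21_iff (by linarith), hM]
    refine ⟨H, hH, hHm, ?_⟩
    rw [e01, e02, e12]
    ext k
    fin_cases k <;> simp <;> ring
  rcases le_total a011 a100 with c1 | c1
  · obtain ⟨H, hH, hHm, e01, e02, e12⟩ := exists_absorb hG hm h111 h011 h101 h110 le_rfl
    set m' := m + 2 * a111 + 2 * a011 + 2 * a101 + 2 * a110 + 4 * 0 with hm'
    obtain ⟨v, hS, hv⟩ := (mem_smul_S21_iff (by positivity)).2 ⟨H, hH, hHm, rfl⟩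
    have hX : (2 * max 0 (r 0 + r 1 + r 2 - 1)) • v ∈ D1 r := Set.smul_mem_smul_set hS
    have hY : (2 * r 0) • v ∈ D2 r :=
      ⟨_, Set.smul_mem_smul_set hS, _, ⟨0, ⟨le_rfl, by linarith⟩, rfl⟩, by ext k; fin_cases k <;> simp [Matrix.vecHead, Matrix.vecTail]⟩
    obtain ⟨t, ht0, ht1, ht⟩ := exists_convex_weight
      (x := 2 * max 0 (r 0 + r 1 + r 2 - 1)) (y := m') (z := 2 * r 0)
      (by
        have : max 0 (r 0 + r 1 + r 2 - 1) ≤ m' / 2 := max_le (by positivity) (by linarith)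
        linarith)
      (by linarith)
    have := hconv (hD1 _ hX) (hD2 _ hY) (sub_nonneg.2 ht1) ht0 (by ring)
    rw [smul_smul, smul_smul, ← add_smul, ← ht] at this
    convert this using 1
    refine Eq.trans ?_ hv.symm
    rw [e01, e02, e12]
    ext k
    fin_cases k <;> simp <;> linarith
  rcases le_total a101 a010 with c2 | c2
  · obtain ⟨H, hH, hHm, e01, e02, e12⟩ := exists_absorb hG hm h111 h100 h101 h110 le_rfl
    have hM : 2 * r 0 = m + 2 * a111 + 2 * a100 + 2 * a101 + 2 * a110 + 4 * 0 := by linarith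
    refine hD2 _ ⟨_, (mem_smul_S21_iff (by positivity)).2 ⟨H, hH, fun x => by rw [hHm, hM], rfl⟩,
      _, ⟨a011 - a100, ⟨by linarith, by linarith⟩, rfl⟩, ?_⟩
    rw [hM, e01, e02, e12]
    ext k
    fin_cases k <;> simp <;> ring
  rcases le_total a110 a001 with c3 | c3
  · obtain ⟨H, hH, hHm, e01, e02, e12⟩ := exists_absorb hG hm h111 h100 h010 h110 le_rfl
    set m' := m + 2 * a111 + 2 * a100 + 2 * a010 + 2 * a110 + 4 * 0 with hm'
    have hm'0 : 0 ≤ m' := by positivity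
    obtain ⟨v, hS, hv⟩ := (mem_smul_S21_iff hm'0).2 ⟨H, hH, hHm, rfl⟩
    have hX : (2 * r 0) • v + ![0, 0, r 1 - r 0] ∈ D2 r :=
      ⟨_, Set.smul_mem_smul_set hS, _, ⟨r 1 - r 0, ⟨by linarith, le_rfl⟩, rfl⟩, rfl⟩
    have hY : (2 * max 0 (r 0 + r 1 - r 2)) • v +
        ![0, min (r 0) (r 2 - r 1), min (r 1) (r 2 - r 0)] ∈ D3 r :=
      ⟨_, Set.smul_mem_smul_set hS, _, rfl, rfl⟩
    have e1 : min (r 1) (r 2 - r 0) = r 1 - r 0 + min (r 0) (r 2 - r 1) := by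
      rw [← min_add_add_left]
      congr 1 <;> ring
    have e2 : max 0 (r 0 + r 1 - r 2) = r 0 - min (r 0) (r 2 - r 1) := by
      rw [← max_sub_sub_left]
      congr 1 <;> ring
    rw [e1, e2] at hY
    have hle : a101 - a010 ≤ min (r 0) (r 2 - r 1) := le_min (by linarith) (by linarith)
    set M := min (r 0) (r 2 - r 1)
    obtain ⟨t, ht0, ht1, ht⟩ := exists_convex_weight (x := 0) (y := a101 - a010) (z := M)
      (by linarith) hle
    have hmem := hconv (hD2 _ hX) (hD3 _ hY) (sub_nonneg.2 ht1) ht0 (by ring)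
    have hM : m' = (1 - t) * (2 * r 0) + t * (2 * (r 0 - M)) := by
      have : m' = 2 * r 0 - 2 * (a101 - a010) := by linarith
      rw [this, ht]; ring
    have hd : a011 - a100 = (1 - t) * (r 1 - r 0) + t * (r 1 - r 0 + M) := by
      have : a011 - a100 = r 1 - r 0 + (a101 - a010) := by linarith
      rw [this, ht]; ring
    have hsum : (1 - t) • ((2 * r 0) • v + ![0, 0, r 1 - r 0]) +
        t • ((2 * (r 0 - M)) • v + ![0, M, r 1 - r 0 + M]) =
        m' • v + ![0, a101 - a010, a011 - a100] := by
      rw [hM, hd, ht]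
      ext k
      fin_cases k <;> simp [Matrix.vecHead, Matrix.vecTail] <;> ring
    rw [hsum] at hmem
    convert hmem using 1
    refine Eq.trans ?_ (congrArg (· + ![0, a101 - a010, a011 - a100]) hv.symm)
    rw [e01, e02, e12]
    ext k
    fin_cases k <;> simp <;> linarith
  · obtain ⟨H, hH, hHm, e01, e02, e12⟩ := exists_absorb hG hm h111 h100 h010 h001
      (sub_nonneg.2 c3)
    have hM : 2 * (r 0 + r 1 - r 2) =
        m + 2 * a111 + 2 * a100 + 2 * a010 + 2 * a001 + 4 * (a110 - a001) := by linarith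
    have hpos : 0 ≤ r 0 + r 1 - r 2 := by linarith
    refine hD3 _ ?_
    rw [D3, max_eq_right hpos, min_eq_right (by linarith), min_eq_right (by linarith)]
    refine ⟨_, (mem_smul_S21_iff (by linarith)).2 ⟨H, hH, fun x => by rw [hHm, hM], rfl⟩, _, rfl, ?_⟩
    rw [hM, e01, e02, e12]
    ext k
    fin_cases k <;> simp <;> linarith

end StandardSlices

theorem mainTheorem1 :
    (∀ r : Fin 3 → ℝ, IsStandardVec r →
      hatSlice r = convexHull ℝ (D1 r ∪ D2 r ∪ D3 r)) ∧
    S21 = {w | ∃ A ∈ elliptope 3,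
      w = (1 / 4 : ℝ) • (upperEntries (fun x y => A x y) + ![1, 1, 1])} ∧
    (∀ s : Fin 3 → ℝ, (∀ x, s x ∈ Set.Icc (0 : ℝ) 1) →
      ∃ σ : Equiv.Perm (Fin 3),
        IsStandardVec (fun x => min (s (σ x)) (1 - s (σ x))) ∧
        ∃ T : (Fin 3 → ℝ) ≃ᵃ[ℝ] (Fin 3 → ℝ),
          hatSlice s = T '' hatSlice (fun x => min (s (σ x)) (1 - s (σ x)))) ∧
    IsClosed (syncQuantumCorr 3 2) :=
  ⟨fun _ hr => (hatSlice_subset_convexHull hr).antisymm (convexHull_subset_hatSlice hr),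
    S21_eq_image_elliptope, fun _ hs => exists_standard_slice hs, isClosed_syncQuantumCorr⟩
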